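/- Consider a Bernoulli bandit with arms $\{1,\dots,K\}$ and means $\mu_1,\dots,\mu_K\in[0,1)$, where arm $1$ is the unique optimal arm and arm $2$ is a best suboptimal arm: $\mu_1>\mu_2\ge\mu_a$ for all $a\ge 3$. Let $A_t$ be the arm drawn by Thompson Sampling with independent uniform priors in round $t$: after $t$ rounds, with $N_{a,t}$ the number of draws of arm $a$ and $S_{a,t}$ the number of successes observed from it, independent samples $\theta_{a,t}\sim\mathrm{Beta}(S_{a,t}+1,\,N_{a,t}-S_{a,t}+1)$ are drawn, the arm with the highest sample is chosen in round $t+1$, and it yields a Bernoulli reward with the mean of that arm. Let $K(p,q)=p\ln\frac pq+(1-p)\ln\frac{1-p}{1-q}$. (i) There are constants $b=b(\mu_1,\mu_2)\in(0,1)$ and $C_b=C_b(K,\mu_1,\mu_2)<\infty$ such that $$\sum_{t=1}^{\infty}\mathbb P\left(N_{1,t}\le t^{b}\right)\le C_b .$$ (ii) There are constants $D(\epsilon,\mu_1,\mu_a)$, $N(b,\epsilon,\mu_1,\mu_a)$ and $N_0(b)$, depending only on the quantities displayed, such that for all $b\in(0,1)$ and $C_b<\infty$ that satisfy the inequality in (i),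 every $\epsilon>0$, every suboptimal arm $a$ and every integer $T\ge 2$, $$\mathbb E[N_{a,T}]\le(1+\epsilon)\,\frac{\ln T+\ln\ln T}{K(\mu_a,\mu_1)}+D(\epsilon,\mu_1,\mu_a)+N(b,\epsilon,\mu_1,\mu_a)+N_0(b)+5+2C_b .$$ (iii) Consequently $\limsup_{T\to\infty}\mathbb E[N_{a,T}]/\ln T\le 1/K(\mu_a,\mu_1)$ for every suboptimal arm $a$, which is the constant of the asymptotic lower bound of Lai and Robbins. -/

import Mathlib

open MeasureTheory ProbabilityTheory Filter
open scoped ENNReal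

noncomputable section

namespace ThompsonBandit

/-- Kullback-Leibler divergence between the Bernoulli distributions with means `p` and `q`. -/
def bernKL (p q : ℝ) : ℝ :=
  p * Real.log (p / q) + (1 - p) * Real.log ((1 - p) / (1 - q))

/-- The observations of the first `t` rounds of a bandit with arms `Fin K`:
for each round the arm that was drawn and the reward (`true` is reward 1, `false` is reward 0). -/
abbrev History (K t : ℕ) : Type := Fin t → Fin K × Bool

variable {K : ℕ}

/-- Number of draws of the arm `a` in a history. -/
def numDraws {t : ℕ} (a : Fin K) (h : History K t) : ℕ :=
  (Finset.univ.filter fun s : Fin t => (h s).1 = a).card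

/-- Number of successes observed from the arm `a` in a history. -/
def numSuccesses {t : ℕ} (a : Fin K) (h : History K t) : ℕ :=
  (Finset.univ.filter fun s : Fin t => h s = (a, true)).card

/-- Posterior distribution of the vector of arm means after a history, for independent uniform
priors: the product over the arms `a` of the laws Beta(S_a + 1, N_a - S_a + 1). -/
def armsPosterior {t : ℕ} (h : History K t) : Measure (Fin K → ℝ) :=
  Measure.pi fun a : Fin K =>
    betaMeasure ((numSuccesses a h : ℝ) + 1) ((numDraws a h : ℝ) - (numSuccesses a h : ℝ) + 1)

/-- The history of the first `t` rounds. Here `A s` and `R s` are the arm drawn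
and the reward received in round `s + 1`, for `s = 0, 1, 2, ...`. -/
def history {Ω : Type*} (A : ℕ → Ω → Fin K) (R : ℕ → Ω → Bool) (t : ℕ) (ω : Ω) : History K t :=
  fun s => (A s ω, R s ω)

/-- `θ`, `A`, `R` are the samples, the arms and the rewards of Thompson Sampling with uniform
priors on the Bernoulli bandit with means `μ`. The sample `θ t` is drawn from the posterior after
`t` rounds and determines the arm `A t` drawn in round `t + 1`, which yields the reward `R t`. -/
structure IsThompsonSampling {Ω : Type*} [MeasurableSpace Ω] (P : Measure Ω) (μ : Fin K → ℝ)
    (θ : ℕ → Ω → Fin K → ℝ) (A : ℕ → Ω → Fin K) (R : ℕ → Ω → Bool) : Prop where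
  measurable_sample : ∀ t, Measurable (θ t)
  measurable_arm : ∀ t, Measurable (A t)
  measurable_reward : ∀ t, Measurable (R t)
  /-- Given the history, the vector of samples is distributed according to the posterior. -/
  sample_law : ∀ (t : ℕ) (h : History K t) (B : Set (Fin K → ℝ)), MeasurableSet B →
    P {ω | history A R t ω = h ∧ θ t ω ∈ B} = P {ω | history A R t ω = h} * armsPosterior h B
  /-- The arm with the highest sample is drawn. -/
  arm_argmax : ∀ t : ℕ, ∀ᵐ ω ∂P, ∀ a : Fin K, θ t ω a ≤ θ t ω (A t ω)
  /-- Given the history and the arm drawn, the reward has the Bernoulli law of that arm. -/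
  reward_law : ∀ (t : ℕ) (h : History K t) (a : Fin K),
    P {ω | history A R t ω = h ∧ A t ω = a ∧ R t ω = true} =
      P {ω | history A R t ω = h ∧ A t ω = a} * ENNReal.ofReal (μ a)

/-- `N_{a,t}`, the number of draws of the arm `a` in the first `t` rounds. -/
def draws {Ω : Type*} (A : ℕ → Ω → Fin K) (R : ℕ → Ω → Bool) (a : Fin K) (t : ℕ) (ω : Ω) : ℕ :=
  numDraws a (history A R t ω)

/-- The sum over `t ≥ 1` of the probabilities that the arm `a` has been drawn at most `t ^ b`
times in the first `t` rounds. -/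
def fewDrawsSum {Ω : Type*} [MeasurableSpace Ω] (P : Measure Ω) (A : ℕ → Ω → Fin K)
    (R : ℕ → Ω → Bool) (a : Fin K) (b : ℝ) : ℝ≥0∞ :=
  ∑' n : ℕ, P {ω | (draws A R a (n + 1) ω : ℝ) ≤ ((n + 1 : ℕ) : ℝ) ^ b}

end ThompsonBandit

end

/-!
Why Thompson Sampling achieves the Lai-Robbins constant. Write `N` and `S` for the draws and
successes of an arm, `i` for the optimal arm, and fix `x < y` strictly between the two largest
means.

*States of an arm.* Each state `(n, k)` of an arm is entered at most once, so that the probability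
of ever reaching it is at most the binomial probability
(`IsThompsonSampling.measure_exists_state_le`). Hence empirical means after many draws are close to
the true means, and posterior samples of arms drawn often are controlled by the large deviation
bounds for the Beta posteriors (`posteriorTail_le_exp`, `posterior_Iic_le_exp`).

*The optimal arm is drawn polynomially often* (`exists_summable_fewDraws`). Given the history, arm
`i` is drawn with probability at least `p * q`, where `p` is the posterior probability that its
sample exceeds `y` and `q` is the probability that no other sample does. So in each round the
conditional probabilities of drawing arm `i`, divided by `p / 2`, and of drawing some other arm that
is not yet settled (drawn few times, or with an empirical mean above `x`) add up to almost one
(`IsThompsonSampling.one_le_sum_drawProb`). If arm `i` has been drawn at most `T ^ b` times, then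
one of these compensators is large although the number of corresponding draws is small, which an
exponential supermartingale excludes (`measure_compensator_ge_le`). The delicate contribution is
that of the states of arm `i` in which `p` is small; it is summable since the probability of such a
state is, up to a constant, at most a power `p ^ (1 + η)` with `η > 0`
(`exists_binomialProb_le_posteriorTail_rpow`). The supermartingale depends on the history alone,
because no independence of the samples of different rounds is available.

*The finite-time bound* (`exists_integral_draws_le`). A suboptimal arm `a` is drawn only if the
sample of arm `i` is at most `y` or its own sample exceeds `y`. The former has summable probability
once `N > t ^ β` for arm `i` (`exists_summable_sample_le`). The latter happens for at most
`ln T / d'` draws before arm `a` is settled, with `d' < K(x, y)` as close to `K(μ_a, μ_i)` as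
desired, and then with probability of order `1 / T` per round
(`IsThompsonSampling.sum_measure_sample_gt_le`). Since `ε` is arbitrary, all lower-order terms can
be absorbed into constants, and dividing by `ln T` gives the asymptotic statement.
-/

namespace ThompsonBandit

/-! ### Binomial probabilities and posterior tails -/

/-- The probability that a binomial variable with parameters `n` and `p` equals `k`. -/
noncomputable def binomialProb (n k : ℕ) (p : ℝ) : ℝ := n.choose k * (p ^ k * (1 - p) ^ (n - k))

/-- The probability that a sample exceeds `y`, under the posterior of an arm drawn `n` times
with `k` successes. -/
noncomputable def posteriorTail (n k : ℕ) (y : ℝ) : ℝ :=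
  (betaMeasure ((k : ℝ) + 1) ((n : ℝ) - (k : ℝ) + 1)).real (Set.Ioi y)

lemma isProbabilityMeasure_posterior {n k : ℕ} (hk : k ≤ n) :
    IsProbabilityMeasure (betaMeasure ((k : ℝ) + 1) ((n : ℝ) - (k : ℝ) + 1)) := by
  have : (k : ℝ) ≤ n := by exact_mod_cast hk
  exact isProbabilityMeasureBeta (by positivity) (by linarith)

lemma binomialProb_nonneg {n k : ℕ} {p : ℝ} (h0 : 0 ≤ p) (h1 : p ≤ 1) :
    0 ≤ binomialProb n k p := by
  have : 0 ≤ 1 - p := by linarith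
  unfold binomialProb; positivity

lemma sum_binomialProb (n : ℕ) (p : ℝ) :
    ∑ k ∈ Finset.range (n + 1), binomialProb n k p = 1 := by
  have := add_pow p (1 - p) n
  simp only [add_sub_cancel, one_pow] at this
  rw [this]
  exact Finset.sum_congr rfl fun k _ => by rw [binomialProb]; ring

lemma binomialProb_le_one {n k : ℕ} {p : ℝ} (hk : k ≤ n) (h0 : 0 ≤ p) (h1 : p ≤ 1) :
    binomialProb n k p ≤ 1 := by
  rw [← sum_binomialProb n p]
  exact Finset.single_le_sum (f := fun k => binomialProb n k p)
    (fun i _ => binomialProb_nonneg h0 h1) (Finset.mem_range_succ_iff.2 hk)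

lemma binomialProb_symm {n k : ℕ} (hk : k ≤ n) (p : ℝ) :
    binomialProb n (n - k) (1 - p) = binomialProb n k p := by
  rw [binomialProb, binomialProb, Nat.choose_symm hk, Nat.sub_sub_self hk, sub_sub_cancel]; ring

/-! ### The Kullback-Leibler divergence -/

lemma bernKL_symm (p q : ℝ) : bernKL (1 - p) (1 - q) = bernKL p q := by
  simp only [bernKL, sub_sub_cancel]; ring

lemma bernKL_pos {p q : ℝ} (hp0 : 0 ≤ p) (hp1 : p < 1) (hq0 : 0 < q) (hq1 : q < 1)
    (hpq : p ≠ q) : 0 < bernKL p q := by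
  have h1p : 0 < 1 - p := by linarith
  have h1q : 0 < 1 - q := by linarith
  have hB : (1 - p) * Real.log ((1 - q) / (1 - p)) < (1 - p) * ((1 - q) / (1 - p) - 1) := by
    refine mul_lt_mul_of_pos_left (Real.log_lt_sub_one_of_pos (by positivity) ?_) h1p
    rw [Ne, div_eq_one_iff_eq h1p.ne']
    exact fun h => hpq (by linarith)
  have hB' : (1 - p) * ((1 - q) / (1 - p) - 1) = p - q := by field_simp; ring
  have hA : p * Real.log (q / p) ≤ q - p := by
    rcases hp0.eq_or_lt with rfl | hp
    · simpa using hq0.le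
    · have := mul_le_mul_of_nonneg_left (Real.log_le_sub_one_of_pos (div_pos hq0 hp)) hp.le
      refine this.trans_eq ?_
      field_simp
  have e1 : Real.log (p / q) = - Real.log (q / p) := by rw [← Real.log_inv, inv_div]
  have e2 : Real.log ((1 - p) / (1 - q)) = - Real.log ((1 - q) / (1 - p)) := by
    rw [← Real.log_inv, inv_div]
  rw [bernKL, e1, e2]
  linarith

/-- Passing from the success probability `v` to `u` changes the log-likelihood of `k` successes
in `n` trials by a quantity that is monotone in `k`. -/
lemma likelihood_le_mul_exp {n k : ℕ} (hk : k ≤ n) {z u v : ℝ} (hv : 0 < v) (hvu : v ≤ u)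
    (hu : u < 1) (hkz : (k : ℝ) ≤ z * n) :
    u ^ k * (1 - u) ^ (n - k) ≤ v ^ k * (1 - v) ^ (n - k) *
      Real.exp (n * (z * Real.log (u / v) + (1 - z) * Real.log ((1 - u) / (1 - v)))) := by
  have hu0 : 0 < u := hv.trans_le hvu
  have h1u : 0 < 1 - u := by linarith
  have h1v : 0 < 1 - v := by linarith
  have e : u ^ k * (1 - u) ^ (n - k) = v ^ k * (1 - v) ^ (n - k) *
      Real.exp (k * Real.log (u / v) + (n - k : ℕ) * Real.log ((1 - u) / (1 - v))) := by
    rw [Real.exp_add, Real.exp_nat_mul, Real.exp_nat_mul, Real.exp_log (by positivity),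
      Real.exp_log (by positivity), div_pow, div_pow]
    field_simp
  rw [e]
  gcongr
  rw [Nat.cast_sub hk]
  have hA : 0 ≤ Real.log (u / v) := Real.log_nonneg (by rwa [le_div_iff₀ hv, one_mul])
  have hB : Real.log ((1 - u) / (1 - v)) ≤ 0 :=
    Real.log_nonpos (by positivity) (by rw [div_le_one h1v]; linarith)
  nlinarith [mul_le_mul_of_nonneg_right hkz (sub_nonneg.2 (hB.trans hA))]

/-- The likelihood is decreasing to the right of the empirical mean. -/
lemma likelihood_antitone {n k : ℕ} (hk : k ≤ n) {u v : ℝ} (hv : 0 < v) (hvu : v ≤ u)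
    (hu : u < 1) (hkv : (k : ℝ) ≤ v * n) :
    u ^ k * (1 - u) ^ (n - k) ≤ v ^ k * (1 - v) ^ (n - k) := by
  have h1v : 0 < 1 - v := by linarith
  refine (likelihood_le_mul_exp hk hv hvu hu hkv).trans ?_
  refine mul_le_of_le_one_right (by positivity) (Real.exp_le_one_iff.2 ?_)
  refine mul_nonpos_of_nonneg_of_nonpos (Nat.cast_nonneg n) ?_
  have hA := mul_le_mul_of_nonneg_left
    (Real.log_le_sub_one_of_pos (div_pos (hv.trans_le hvu) hv)) hv.le
  have hB := mul_le_mul_of_nonneg_left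
    (Real.log_le_sub_one_of_pos (div_pos (sub_pos.2 hu) h1v)) h1v.le
  have eA : v * (u / v - 1) = u - v := by field_simp
  have eB : (1 - v) * ((1 - u) / (1 - v) - 1) = v - u := by field_simp; ring
  linarith

/-- The likelihood is increasing to the left of the empirical mean. -/
lemma likelihood_monotone {n k : ℕ} (hk : k ≤ n) {u v : ℝ} (hu : 0 < u) (huv : u ≤ v)
    (hv : v < 1) (hkv : v * n ≤ k) :
    u ^ k * (1 - u) ^ (n - k) ≤ v ^ k * (1 - v) ^ (n - k) := by
  have := likelihood_antitone (n := n) (k := n - k) (Nat.sub_le _ _) (u := 1 - u) (v := 1 - v)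
    (by linarith) (by linarith) (by linarith) (by rw [Nat.cast_sub hk]; linarith)
  rw [Nat.sub_sub_self hk, sub_sub_cancel, sub_sub_cancel] at this
  linarith

lemma binomialProb_le_exp {n k : ℕ} (hk : k ≤ n) {x y u : ℝ} (hx : 0 < x) (hxy : x ≤ y)
    (hyu : y ≤ u) (hu : u < 1) (hkx : (k : ℝ) ≤ x * n) :
    binomialProb n k u ≤ Real.exp (-(n * bernKL x y)) := by
  have hy : 0 < y := hx.trans_le hxy
  have hy1 : y < 1 := hyu.trans_lt hu
  have h1 : binomialProb n k u ≤ binomialProb n k y := by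
    refine mul_le_mul_of_nonneg_left (likelihood_antitone hk hy hyu hu ?_) (Nat.cast_nonneg _)
    exact hkx.trans (by gcongr)
  refine h1.trans ?_
  have h2 : binomialProb n k y ≤ binomialProb n k x *
      Real.exp (n * (x * Real.log (y / x) + (1 - x) * Real.log ((1 - y) / (1 - x)))) := by
    rw [binomialProb, binomialProb, mul_assoc (n.choose k : ℝ)]
    exact mul_le_mul_of_nonneg_left (likelihood_le_mul_exp hk hx hxy hy1 hkx) (Nat.cast_nonneg _)
  have h3 : binomialProb n k x ≤ 1 := binomialProb_le_one hk hx.le (by linarith)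
  refine h2.trans ((mul_le_of_le_one_left (Real.exp_nonneg _) h3).trans_eq ?_)
  have e1 : Real.log (x / y) = - Real.log (y / x) := by rw [← Real.log_inv, inv_div]
  have e2 : Real.log ((1 - x) / (1 - y)) = - Real.log ((1 - y) / (1 - x)) := by
    rw [← Real.log_inv, inv_div]
  rw [bernKL, e1, e2]
  ring_nf

/-! ### Bounds on the posterior tails -/

lemma betaMeasure_real_eq {n k : ℕ} (hk : k ≤ n) {s : Set ℝ} (hs : MeasurableSet s) :
    (betaMeasure ((k : ℝ) + 1) ((n : ℝ) - (k : ℝ) + 1)).real s =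
      ∫ u in s ∩ Set.Ioo 0 1, (n + 1) * binomialProb n k u := by
  have hbeta : 1 / beta ((k : ℝ) + 1) ((n : ℝ) - k + 1) = (n + 1) * n.choose k := by
    have e : (n : ℝ) - k = ((n - k : ℕ) : ℝ) := (Nat.cast_sub hk).symm
    have e2 : (k : ℝ) + 1 + (((n - k : ℕ) : ℝ) + 1) = ((n + 1 : ℕ) : ℝ) + 1 := by
      rw [Nat.cast_sub hk]; push_cast; ring
    rw [beta, e, e2, Real.Gamma_nat_eq_factorial, Real.Gamma_nat_eq_factorial,
      Real.Gamma_nat_eq_factorial, Nat.factorial_succ, one_div_div, div_eq_iff (by positivity),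
      ← Nat.choose_mul_factorial_mul_factorial hk]
    push_cast; ring
  have hpdf : ∀ u, betaPDF ((k : ℝ) + 1) ((n : ℝ) - (k : ℝ) + 1) u =
      (Set.Ioo (0 : ℝ) 1).indicator
        (fun u => ENNReal.ofReal ((n + 1) * binomialProb n k u)) u := by
    intro u
    rw [betaPDF_eq]
    by_cases hu : 0 < u ∧ u < 1
    · rw [if_pos hu, Set.indicator_of_mem (show u ∈ Set.Ioo (0 : ℝ) 1 from hu), hbeta]
      congr 1
      rw [add_sub_cancel_right, add_sub_cancel_right, ← Nat.cast_sub hk, Real.rpow_natCast,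
        Real.rpow_natCast, binomialProb]
      ring
    · rw [if_neg hu, Set.indicator_of_notMem (show u ∉ Set.Ioo (0 : ℝ) 1 from hu),
        ENNReal.ofReal_zero]
  rw [Measure.real, betaMeasure, withDensity_apply _ hs]
  simp_rw [hpdf]
  rw [lintegral_indicator measurableSet_Ioo, Measure.restrict_restrict measurableSet_Ioo,
    Set.inter_comm, integral_eq_lintegral_of_nonneg_ae]
  · refine ae_restrict_of_forall_mem (hs.inter measurableSet_Ioo) fun u hu => ?_
    have := binomialProb_nonneg (n := n) (k := k) hu.2.1.le hu.2.2.le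
    simp only [Pi.zero_apply]; positivity
  · unfold binomialProb
    exact (by fun_prop : Continuous fun u : ℝ =>
      ((n : ℝ) + 1) * (n.choose k * (u ^ k * (1 - u) ^ (n - k)))).aestronglyMeasurable

lemma integrableOn_binomialProb (n k : ℕ) {s : Set ℝ} (hs : s ⊆ Set.Icc 0 1) :
    IntegrableOn (fun u => ((n : ℝ) + 1) * binomialProb n k u) s := by
  have : Continuous fun u : ℝ => ((n : ℝ) + 1) * binomialProb n k u := by
    unfold binomialProb; fun_prop
  exact (this.integrableOn_Icc).mono_set hs

lemma betaMeasure_real_le {n k : ℕ} (hk : k ≤ n) {s : Set ℝ} (hs : MeasurableSet s) {c : ℝ}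
    (hc : 0 ≤ c) (h : ∀ u ∈ s, 0 < u → u < 1 → binomialProb n k u ≤ c) :
    (betaMeasure ((k : ℝ) + 1) ((n : ℝ) - (k : ℝ) + 1)).real s ≤ (n + 1) * c := by
  rw [betaMeasure_real_eq hk hs]
  have hvol : volume (s ∩ Set.Ioo (0 : ℝ) 1) ≤ 1 := by
    refine (measure_mono Set.inter_subset_right).trans ?_
    simp
  have hvol' : (volume (s ∩ Set.Ioo (0 : ℝ) 1)).toReal ≤ 1 :=
    ENNReal.toReal_le_of_le_ofReal zero_le_one (by simpa using hvol)
  calc ∫ u in s ∩ Set.Ioo 0 1, (n + 1) * binomialProb n k u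
      ≤ ∫ u in s ∩ Set.Ioo (0 : ℝ) 1, (n + 1) * c := by
        refine setIntegral_mono_on
          (integrableOn_binomialProb n k (Set.inter_subset_right.trans Set.Ioo_subset_Icc_self))
          (integrableOn_const (ne_top_of_le_ne_top ENNReal.one_ne_top hvol))
          (hs.inter measurableSet_Ioo) fun u hu => ?_
        exact mul_le_mul_of_nonneg_left (h u hu.1 hu.2.1 hu.2.2) (by positivity)
    _ ≤ (n + 1) * c := by
        rw [setIntegral_const, smul_eq_mul]
        exact mul_le_of_le_one_left (by positivity) hvol'

lemma posteriorTail_le_exp {n k : ℕ} (hk : k ≤ n) {x y : ℝ} (hx : 0 < x) (hxy : x ≤ y)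
    (hkx : (k : ℝ) ≤ x * n) :
    posteriorTail n k y ≤ (n + 1) * Real.exp (-(n * bernKL x y)) :=
  betaMeasure_real_le hk measurableSet_Ioi (Real.exp_nonneg _) fun _ hu _ hu1 =>
    binomialProb_le_exp hk hx hxy (Set.mem_Ioi.1 hu).le hu1 hkx

lemma posterior_Iic_le_exp {n k : ℕ} (hk : k ≤ n) {x y : ℝ} (hyx : y ≤ x) (hx : x < 1)
    (hkx : x * n ≤ k) :
    (betaMeasure ((k : ℝ) + 1) ((n : ℝ) - (k : ℝ) + 1)).real (Set.Iic y) ≤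
      (n + 1) * Real.exp (-(n * bernKL x y)) := by
  refine betaMeasure_real_le hk measurableSet_Iic (Real.exp_nonneg _) fun u hu hu0 _ => ?_
  rw [← binomialProb_symm hk, ← bernKL_symm]
  exact binomialProb_le_exp (Nat.sub_le _ _) (by linarith) (by linarith)
    (by linarith [Set.mem_Iic.1 hu]) (by linarith) (by rw [Nat.cast_sub hk]; linarith)

lemma mul_le_posteriorTail {n k : ℕ} (hk : k ≤ n) {y : ℝ} (hy : 0 < y) (hy1 : y < 1) :
    (1 - y) * binomialProb n k y ≤ posteriorTail n k y := by
  have hset : Set.Ioi y ∩ Set.Ioo 0 1 = Set.Ioo y 1 := by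
    ext u; simp only [Set.mem_inter_iff, Set.mem_Ioi, Set.mem_Ioo]
    exact ⟨fun h => ⟨h.1, h.2.2⟩, fun h => ⟨h.1, hy.trans h.1, h.2⟩⟩
  rw [posteriorTail, betaMeasure_real_eq hk measurableSet_Ioi, hset]
  have hint : ∫ u in y..1, (1 - u) ^ (n - k) = (1 - y) ^ (n - k + 1) / ((n - k : ℕ) + 1) := by
    rw [intervalIntegral.integral_comp_sub_left (fun u => u ^ (n - k)) 1, integral_pow]
    simp
  have hle : ((n - k : ℕ) : ℝ) + 1 ≤ n + 1 := by
    have : ((n - k : ℕ) : ℝ) ≤ n := by exact_mod_cast Nat.sub_le n k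
    linarith
  have h1y : 0 < 1 - y := by linarith
  calc (1 - y) * binomialProb n k y
      = n.choose k * y ^ k * (1 - y) ^ (n - k + 1) := by rw [binomialProb]; ring
    _ ≤ (n + 1) / ((n - k : ℕ) + 1) * (n.choose k * y ^ k * (1 - y) ^ (n - k + 1)) :=
        le_mul_of_one_le_left (by positivity) ((one_le_div (by positivity)).2 hle)
    _ = ∫ u in Set.Ioo y 1, (n + 1) * (n.choose k * y ^ k) * (1 - u) ^ (n - k) := by
        rw [← integral_Ioc_eq_integral_Ioo, ← intervalIntegral.integral_of_le hy1.le,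
          intervalIntegral.integral_const_mul, hint]
        ring
    _ ≤ _ := by
        refine setIntegral_mono_on ?_ (integrableOn_binomialProb n k ?_) measurableSet_Ioo ?_
        · exact ((by fun_prop : Continuous fun u : ℝ => ((n : ℝ) + 1) * (n.choose k * y ^ k) *
            (1 - u) ^ (n - k)).integrableOn_Icc).mono_set Set.Ioo_subset_Icc_self
        · exact fun u hu => ⟨hy.le.trans hu.1.le, hu.2.le⟩
        · intro u hu
          have h1u : 0 ≤ 1 - u := by linarith [hu.2]
          have : y ^ k ≤ u ^ k := pow_le_pow_left₀ hy.le hu.1.le k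
          rw [binomialProb, mul_assoc, mul_assoc]
          gcongr

/-- If the empirical mean is at least `z > y`, then a sample exceeds `y` with probability bounded
below: the posterior density is increasing on `[0, z]`, so the mass of `[0, y]` is at most
`y / (z - y)` times that of `[y, z]`. -/
lemma le_posteriorTail_of_le {n k : ℕ} (hk : k ≤ n) {y z : ℝ} (hy : 0 < y) (hyz : y < z)
    (hz : z < 1) (hkz : z * n ≤ k) : 1 - y / z ≤ posteriorTail n k y := by
  have hprob := isProbabilityMeasure_posterior hk
  set c : ℝ := (n + 1) * binomialProb n k y
  have hc : 0 ≤ c := mul_nonneg (by positivity) (binomialProb_nonneg hy.le (by linarith))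
  have hmono : ∀ u v : ℝ, 0 < u → u ≤ v → v ≤ z →
      (n + 1) * binomialProb n k u ≤ (n + 1) * binomialProb n k v := by
    intro u v hu huv hv
    refine mul_le_mul_of_nonneg_left (mul_le_mul_of_nonneg_left ?_ (Nat.cast_nonneg _))
      (by positivity)
    refine likelihood_monotone hk hu huv (by linarith) (le_trans ?_ hkz)
    gcongr
  have h1 : (z - y) * c ≤ posteriorTail n k y := by
    rw [posteriorTail, betaMeasure_real_eq hk measurableSet_Ioi]
    calc (z - y) * c = ∫ u in Set.Ioc y z, c := by
          rw [setIntegral_const, smul_eq_mul, Measure.real, Real.volume_Ioc,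
            ENNReal.toReal_ofReal (by linarith)]
      _ ≤ ∫ u in Set.Ioc y z, (n + 1) * binomialProb n k u := by
          refine setIntegral_mono_on (integrableOn_const (by simp))
            (integrableOn_binomialProb n k fun u hu => ⟨by linarith [hu.1], by linarith [hu.2]⟩)
            measurableSet_Ioc fun u hu => hmono y u hy hu.1.le hu.2
      _ ≤ _ := by
          refine setIntegral_mono_set
            (integrableOn_binomialProb n k
              (Set.inter_subset_right.trans Set.Ioo_subset_Icc_self)) ?_ ?_
          · refine ae_restrict_of_forall_mem (measurableSet_Ioi.inter measurableSet_Ioo)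
              fun u hu => ?_
            exact mul_nonneg (by positivity) (binomialProb_nonneg hu.2.1.le hu.2.2.le)
          · refine Eventually.of_forall fun u hu => ?_
            exact ⟨hu.1, hy.trans hu.1, hu.2.trans_lt hz⟩
  have h2 : 1 - posteriorTail n k y ≤ y * c := by
    rw [posteriorTail, ← probReal_compl_eq_one_sub measurableSet_Ioi, Set.compl_Ioi,
      betaMeasure_real_eq hk measurableSet_Iic]
    calc ∫ u in Set.Iic y ∩ Set.Ioo 0 1, (n + 1) * binomialProb n k u
        = ∫ u in Set.Ioc 0 y, (n + 1) * binomialProb n k u := by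
          congr 2
          ext u
          simp only [Set.mem_inter_iff, Set.mem_Iic, Set.mem_Ioo, Set.mem_Ioc]
          exact ⟨fun h => ⟨h.2.1, h.1⟩, fun h => ⟨h.2, h.1, by linarith⟩⟩
      _ ≤ ∫ u in Set.Ioc 0 y, c := by
          refine setIntegral_mono_on (integrableOn_binomialProb n k fun u hu =>
            ⟨hu.1.le, by linarith [hu.2]⟩) (integrableOn_const (by simp)) measurableSet_Ioc
            fun u hu => hmono u y hu.1 hu.2 hyz.le
      _ = y * c := by
          rw [setIntegral_const, smul_eq_mul, Measure.real, Real.volume_Ioc,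
            ENNReal.toReal_ofReal (by linarith), sub_zero]
  have hz0 : 0 < z := hy.trans hyz
  rw [sub_le_iff_le_add, ← sub_le_iff_le_add', le_div_iff₀ hz0]
  nlinarith [mul_le_mul_of_nonneg_left h1 hy.le, mul_le_mul_of_nonneg_left h2 (sub_pos.2 hyz).le]

lemma posteriorTail_le_one {n k : ℕ} (hk : k ≤ n) (y : ℝ) : posteriorTail n k y ≤ 1 := by
  have := isProbabilityMeasure_posterior hk
  exact measureReal_le_one

lemma posteriorTail_pos {n k : ℕ} (hk : k ≤ n) {y : ℝ} (hy : 0 < y) (hy1 : y < 1) :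
    0 < posteriorTail n k y := by
  refine lt_of_lt_of_le ?_ (mul_le_posteriorTail hk hy hy1)
  have h1y : 0 < 1 - y := by linarith
  have : 0 < n.choose k := Nat.choose_pos hk
  unfold binomialProb; positivity

/-! ### Binomial deviations -/

lemma sum_binomialProb_mul_exp_le (n : ℕ) {p s x : ℝ} (h0 : 0 ≤ p) (h1 : p ≤ 1)
    (hs : |s| ≤ 1) :
    ∑ k ∈ Finset.range (n + 1), binomialProb n k p * Real.exp (s * (k - x * n)) ≤
      Real.exp (n * (s * (p - x) + s ^ 2)) := by
  have e : ∑ k ∈ Finset.range (n + 1), binomialProb n k p * Real.exp (s * (k - x * n)) =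
      Real.exp (-(s * x)) ^ n * (p * Real.exp s + (1 - p)) ^ n := by
    rw [add_pow, Finset.mul_sum]
    refine Finset.sum_congr rfl fun k _ => ?_
    rw [mul_pow, ← Real.exp_nat_mul, ← Real.exp_nat_mul, binomialProb,
      show s * ((k : ℝ) - x * n) = n * (-(s * x)) + k * s by ring, Real.exp_add]
    ring
  rw [e, ← mul_pow, Real.exp_nat_mul]
  have hes : 0 < Real.exp s := Real.exp_pos s
  have h2 : 0 ≤ p * Real.exp s + (1 - p) := by nlinarith [mul_nonneg h0 hes.le]
  refine pow_le_pow_left₀ (by positivity) ?_ n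
  have hb := (abs_le.1 (Real.abs_exp_sub_one_sub_id_le hs)).2
  have h3 : p * Real.exp s + (1 - p) ≤ Real.exp (p * s + s ^ 2) := by
    refine le_trans ?_ (Real.add_one_le_exp _)
    nlinarith [mul_le_mul_of_nonneg_left hb h0, sq_nonneg s,
      mul_le_mul_of_nonneg_right h1 (sq_nonneg s)]
  calc Real.exp (-(s * x)) * (p * Real.exp s + (1 - p))
      ≤ Real.exp (-(s * x)) * Real.exp (p * s + s ^ 2) := by gcongr
    _ = Real.exp (s * (p - x) + s ^ 2) := by rw [← Real.exp_add]; ring_nf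

/-- Chernoff bound for the upper tail, uniform over the success probabilities `p ≤ m`. -/
lemma sum_binomialProb_gt_le (n : ℕ) {p m x : ℝ} (h0 : 0 ≤ p) (hpm : p ≤ m) (hmx : m < x)
    (hx : x ≤ 1) :
    ∑ k ∈ Finset.range (n + 1) with x * n < ((k : ℕ) : ℝ), binomialProb n k p ≤
      Real.exp (-((x - m) ^ 2 / 4)) ^ n := by
  set s := (x - m) / 2
  have hs0 : 0 < s := by simp only [s]; linarith
  have hs1 : s ≤ 1 := by simp only [s]; linarith
  have key := sum_binomialProb_mul_exp_le n (x := x) h0 (by linarith)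
    (abs_le.2 ⟨by linarith, hs1⟩)
  calc _ ≤ ∑ k ∈ Finset.range (n + 1) with x * n < ((k : ℕ) : ℝ),
        binomialProb n k p * Real.exp (s * (k - x * n)) := by
        refine Finset.sum_le_sum fun k hk => ?_
        refine le_mul_of_one_le_right (binomialProb_nonneg h0 (by linarith)) ?_
        refine Real.one_le_exp (mul_nonneg hs0.le ?_)
        linarith [(Finset.mem_filter.1 hk).2]
    _ ≤ ∑ k ∈ Finset.range (n + 1), binomialProb n k p * Real.exp (s * (k - x * n)) :=
        Finset.sum_le_sum_of_subset_of_nonneg (Finset.filter_subset _ _) fun k _ _ =>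
          mul_nonneg (binomialProb_nonneg h0 (by linarith)) (Real.exp_nonneg _)
    _ ≤ _ := key
    _ ≤ _ := by
        rw [← Real.exp_nat_mul, Real.exp_le_exp]
        gcongr
        simp only [s] at *
        nlinarith

lemma sum_binomialProb_lt_le (n : ℕ) {p x : ℝ} (h0 : 0 ≤ x) (hxp : x < p) (hp : p ≤ 1) :
    ∑ k ∈ Finset.range (n + 1) with ((k : ℕ) : ℝ) < x * n, binomialProb n k p ≤
      Real.exp (-((p - x) ^ 2 / 4)) ^ n := by
  have h := sum_binomialProb_gt_le n (p := 1 - p) (m := 1 - p) (x := 1 - x) (by linarith) le_rfl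
    (by linarith) (by linarith)
  rw [show (1 - x - (1 - p)) = p - x by ring] at h
  refine le_trans (le_of_eq ?_) h
  rw [Finset.sum_filter, Finset.sum_filter, ← Finset.sum_range_reflect]
  refine Finset.sum_congr rfl fun k hk => ?_
  have hk : k ≤ n := Finset.mem_range_succ_iff.1 hk
  rw [add_tsub_cancel_right, ← binomialProb_symm (Nat.sub_le n k), Nat.sub_sub_self hk]
  rw [Nat.cast_sub hk]
  refine if_congr ?_ rfl rfl
  constructor <;> intro h' <;> linarith

/-- An arm with success probability `p > y` rarely reaches a state in which its samples rarely
exceed `y`: up to a constant, the probability of the state is at most a power greater than one of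
the posterior tail there. The ratio of the likelihoods at `p` and at `y` decays exponentially in
`n` when the empirical mean is at most some `z > y`, which pays for a small power of the
likelihood at `y`. -/
lemma exists_binomialProb_le_posteriorTail_rpow {y p : ℝ} (hy : 0 < y) (hyp : y < p)
    (hp : p < 1) :
    ∃ η C : ℝ, 0 < η ∧ η ≤ 1 ∧ 0 < C ∧ ∀ n k : ℕ, k ≤ n →
      binomialProb n k p ≤ C * posteriorTail n k y ^ (1 + η) := by
  have hy1 : y < 1 := hyp.trans hp
  have hp0 : 0 < p := hy.trans hyp
  have h1y : 0 < 1 - y := by linarith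
  have h1p : 0 < 1 - p := by linarith
  -- the drift `g z` of the log-likelihood ratio is negative at `z = y`, hence also nearby
  set g : ℝ → ℝ := fun z => z * Real.log (p / y) + (1 - z) * Real.log ((1 - p) / (1 - y)) with hg
  have hgy : g y < 0 := by
    have := bernKL_pos hy.le hy1 hp0 hp hyp.ne
    have e1 : Real.log (y / p) = - Real.log (p / y) := by rw [← Real.log_inv, inv_div]
    have e2 : Real.log ((1 - y) / (1 - p)) = - Real.log ((1 - p) / (1 - y)) := by
      rw [← Real.log_inv, inv_div]
    rw [bernKL, e1, e2] at this
    simp only [hg]; linarith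
  have hgc : Continuous g := by simp only [hg]; fun_prop
  obtain ⟨z, hz, hyz, hzp⟩ : ∃ z, g z < 0 ∧ y < z ∧ z < p := by
    have h1 : ∀ᶠ z in nhdsWithin y (Set.Ioi y), g z < 0 :=
      (hgc.continuousAt.eventually_lt continuousAt_const hgy).filter_mono nhdsWithin_le_nhds
    have h2 : ∀ᶠ z in nhdsWithin y (Set.Ioi y), z ∈ Set.Ioo y p := Ioo_mem_nhdsGT hyp
    obtain ⟨z, h, h'⟩ := (h1.and h2).exists
    exact ⟨z, h, h'.1, h'.2⟩
  set m := min y (1 - y)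
  have hm0 : 0 < m := lt_min hy h1y
  have hm1 : m < 1 := (min_le_left _ _).trans_lt hy1
  have hlm : 0 < - Real.log m := by linarith [Real.log_neg hm0 hm1]
  set η := min 1 (-g z / -Real.log m)
  have hη0 : 0 < η := lt_min one_pos (div_pos (by linarith) hlm)
  have hη1 : η ≤ 1 := min_le_left _ _
  have hηz : g z ≤ η * Real.log m := by
    have := (le_div_iff₀ hlm).1 (min_le_right 1 (-g z / -Real.log m))
    change η * _ ≤ _ at this
    linarith
  have hc : 0 < 1 - y / z := by
    rw [sub_pos, div_lt_one (hy.trans hyz)]; exact hyz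
  refine ⟨η, max ((1 - y / z) ^ (-(1 + η))) ((1 - y) ^ (-(1 + η))), hη0, hη1,
    lt_max_of_lt_left (Real.rpow_pos_of_pos hc _), fun n k hk => ?_⟩
  have hpos := posteriorTail_pos hk hy hy1
  have hpow : 0 < posteriorTail n k y ^ (1 + η) := Real.rpow_pos_of_pos hpos _
  rcases le_or_gt (z * n) k with h | h
  · have h1 := le_posteriorTail_of_le hk hy hyz (hzp.trans hp) h
    calc binomialProb n k p ≤ 1 := binomialProb_le_one hk hp0.le hp.le
      _ = (1 - y / z) ^ (-(1 + η)) * (1 - y / z) ^ (1 + η) := by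
          rw [← Real.rpow_add hc]; simp
      _ ≤ _ := by
          gcongr
          exact le_max_left _ _
  · have hB : 0 < binomialProb n k y := by
      have := Nat.choose_pos hk
      unfold binomialProb; positivity
    have h1 : binomialProb n k p ≤ binomialProb n k y * Real.exp (n * g z) := by
      rw [binomialProb, binomialProb, mul_assoc (n.choose k : ℝ)]
      exact mul_le_mul_of_nonneg_left (likelihood_le_mul_exp hk hy hyp.le hp h.le)
        (Nat.cast_nonneg _)
    have h2 : m ^ n ≤ binomialProb n k y := by
      calc m ^ n = m ^ k * m ^ (n - k) := by rw [← pow_add, Nat.add_sub_cancel' hk]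
        _ ≤ y ^ k * (1 - y) ^ (n - k) := by
            gcongr
            · exact min_le_left _ _
            · exact min_le_right _ _
        _ ≤ _ := by
            refine le_mul_of_one_le_left (by positivity) ?_
            exact_mod_cast Nat.choose_pos hk
    have h3 : Real.exp (n * g z) ≤ binomialProb n k y ^ η := by
      calc Real.exp (n * g z) ≤ Real.exp (n * (η * Real.log m)) := by gcongr
        _ = (m ^ n) ^ η := by
            rw [← Real.rpow_natCast, ← Real.rpow_mul hm0.le, Real.rpow_def_of_pos hm0]
            ring_nf
        _ ≤ _ := by gcongr
    calc binomialProb n k p ≤ binomialProb n k y * binomialProb n k y ^ η :=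
          h1.trans (by gcongr)
      _ = binomialProb n k y ^ (1 + η) := by rw [Real.rpow_add hB, Real.rpow_one]
      _ = (1 - y) ^ (-(1 + η)) * ((1 - y) * binomialProb n k y) ^ (1 + η) := by
          rw [Real.mul_rpow h1y.le hB.le, ← mul_assoc, ← Real.rpow_add h1y]; simp
      _ ≤ _ := by
          gcongr
          · exact le_max_right _ _
          · exact mul_le_posteriorTail hk hy hy1

section Rounds

variable {K : ℕ} {Ω : Type*} {A : ℕ → Ω → Fin K} {R : ℕ → Ω → Bool}

/-! ### Draws and successes of an arm -/

/-- `S_{a,t}`, the number of successes of the arm `a` in the first `t` rounds. -/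
def successes (A : ℕ → Ω → Fin K) (R : ℕ → Ω → Bool) (a : Fin K) (t : ℕ) (ω : Ω) : ℕ :=
  numSuccesses a (history A R t ω)

lemma numSuccesses_le_numDraws {t : ℕ} (a : Fin K) (h : History K t) :
    numSuccesses a h ≤ numDraws a h := by
  refine Finset.card_le_card fun s hs => ?_
  simp only [Finset.mem_filter, Finset.mem_univ, true_and] at hs ⊢
  rw [hs]

lemma draws_zero (a : Fin K) (ω : Ω) : draws A R a 0 ω = 0 := by
  simp [draws, numDraws]

lemma draws_succ (a : Fin K) (t : ℕ) (ω : Ω) :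
    draws A R a (t + 1) ω = draws A R a t ω + if A t ω = a then 1 else 0 := by
  rw [draws, draws, numDraws, numDraws, Finset.card_filter, Finset.card_filter,
    Fin.sum_univ_castSucc]
  rfl

lemma successes_succ (a : Fin K) (t : ℕ) (ω : Ω) :
    successes A R a (t + 1) ω =
      successes A R a t ω + if A t ω = a ∧ R t ω = true then 1 else 0 := by
  rw [successes, successes, numSuccesses, numSuccesses, Finset.card_filter, Finset.card_filter,
    Fin.sum_univ_castSucc]
  simp [history]

lemma draws_mono (a : Fin K) (ω : Ω) : Monotone fun t => draws A R a t ω :=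
  monotone_nat_of_le_succ fun t => by rw [draws_succ]; omega

lemma draws_eq_sum (a : Fin K) (T : ℕ) (ω : Ω) :
    (draws A R a T ω : ℝ) = ∑ t ∈ Finset.range T, if A t ω = a then 1 else 0 := by
  induction T with
  | zero => simp [draws_zero]
  | succ T ih => rw [draws_succ, Finset.sum_range_succ, ← ih]; push_cast; rfl

/-- At most `L` draws of an arm happen while it has been drawn fewer than `L` times. -/
lemma sum_draws_lt_le (a : Fin K) (L T : ℕ) (ω : Ω) :
    ∑ t ∈ Finset.range T, (if A t ω = a ∧ draws A R a t ω < L then (1 : ℝ) else 0) ≤ L := by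
  have : ∑ t ∈ Finset.range T, (if A t ω = a ∧ draws A R a t ω < L then (1 : ℝ) else 0) =
      (min (draws A R a T ω) L : ℕ) := by
    induction T with
    | zero => simp [draws_zero]
    | succ T ih =>
      rw [Finset.sum_range_succ, ih, draws_succ]
      by_cases h1 : A T ω = a <;> by_cases h2 : draws A R a T ω < L <;> simp only [h1, h2, and_true,
        and_false, if_true, if_false, add_zero]
      · rw [min_eq_left h2.le, min_eq_left (by omega)]; push_cast; rfl
      · rw [min_eq_right (by omega), min_eq_right (by omega)]
  rw [this]
  exact_mod_cast min_le_right _ _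

variable [MeasurableSpace Ω] {P : Measure Ω} {μ : Fin K → ℝ} {θ : ℕ → Ω → Fin K → ℝ}

lemma measurable_history (hA : ∀ t, Measurable (A t)) (hR : ∀ t, Measurable (R t)) (t : ℕ) :
    Measurable (history A R t) :=
  measurable_pi_lambda _ fun s => (hA s).prodMk (hR s)

lemma measurableSet_history (hA : ∀ t, Measurable (A t)) (hR : ∀ t, Measurable (R t)) (t : ℕ)
    (Q : History K t → Prop) : MeasurableSet {ω | Q (history A R t ω)} :=
  measurable_history hA hR t (Set.toFinite {h | Q h}).measurableSet

lemma measure_history_eq_sum (hA : ∀ t, Measurable (A t)) (hR : ∀ t, Measurable (R t)) (t : ℕ)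
    (Q : History K t → Prop) [DecidablePred Q] {E : Set Ω} (hE : MeasurableSet E) :
    P {ω | Q (history A R t ω) ∧ ω ∈ E} =
      ∑ h with Q h, P {ω | history A R t ω = h ∧ ω ∈ E} := by
  rw [← measure_biUnion_finset]
  · congr 1; ext ω
    simp
  · intro h _ h' _ hne
    refine Set.disjoint_left.2 fun ω hω hω' => hne ?_
    exact hω.1.symm.trans hω'.1
  · exact fun h _ => (measurableSet_history hA hR t (· = h)).inter hE

namespace IsThompsonSampling

lemma measure_reward_true (hTS : IsThompsonSampling P μ θ A R) (a : Fin K) (t : ℕ)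
    (Q : History K t → Prop) :
    P {ω | Q (history A R t ω) ∧ A t ω = a ∧ R t ω = true} =
      P {ω | Q (history A R t ω) ∧ A t ω = a} * ENNReal.ofReal (μ a) := by
  classical
  have hEA : MeasurableSet {ω | A t ω = a} := hTS.measurable_arm t (measurableSet_singleton a)
  have hER : MeasurableSet {ω | R t ω = true} :=
    hTS.measurable_reward t (measurableSet_singleton true)
  have h1 := measure_history_eq_sum (P := P) hTS.measurable_arm hTS.measurable_reward t Q
    (hEA.inter hER)
  have h2 := measure_history_eq_sum (P := P) hTS.measurable_arm hTS.measurable_reward t Q hEA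
  refine h1.trans (Eq.trans ?_ (congrArg (· * ENNReal.ofReal (μ a)) h2.symm))
  simp only [Finset.sum_mul]
  exact Finset.sum_congr rfl fun h _ => hTS.reward_law t h a

lemma measure_reward_false [IsProbabilityMeasure P] (hTS : IsThompsonSampling P μ θ A R)
    (a : Fin K) (h0 : 0 ≤ μ a) (t : ℕ) (Q : History K t → Prop) :
    P {ω | Q (history A R t ω) ∧ A t ω = a ∧ R t ω = false} =
      P {ω | Q (history A R t ω) ∧ A t ω = a} * ENNReal.ofReal (1 - μ a) := by
  have hER : MeasurableSet {ω | R t ω = true} :=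
    hTS.measurable_reward t (measurableSet_singleton true)
  have h := measure_inter_add_sdiff (μ := P) {ω | Q (history A R t ω) ∧ A t ω = a} hER
  have e1 : {ω | Q (history A R t ω) ∧ A t ω = a} ∩ {ω | R t ω = true} =
      {ω | Q (history A R t ω) ∧ A t ω = a ∧ R t ω = true} := by ext ω; simp [and_assoc]
  have e2 : {ω | Q (history A R t ω) ∧ A t ω = a} \ {ω | R t ω = true} =
      {ω | Q (history A R t ω) ∧ A t ω = a ∧ R t ω = false} := by ext ω; simp [and_assoc]
  rw [e1, e2, hTS.measure_reward_true] at h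
  rw [ENNReal.ofReal_sub _ h0, ENNReal.ofReal_one, ENNReal.mul_sub (fun _ _ => measure_ne_top _ _),
    mul_one]
  conv_rhs => enter [1]; rw [← h]
  rw [ENNReal.add_sub_cancel_left]
  exact ENNReal.mul_ne_top (measure_ne_top _ _) ENNReal.ofReal_ne_top

/-- The `n + 1`-st draw of an arm happens in at most one round. -/
lemma tsum_measure_draw_le (hTS : IsThompsonSampling P μ θ A R) (a : Fin K) (n : ℕ)
    (Q : ℕ → Prop) :
    ∑' t, P {ω | (draws A R a t ω = n ∧ Q (successes A R a t ω)) ∧ A t ω = a} ≤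
      P {ω | ∃ t, draws A R a t ω = n ∧ Q (successes A R a t ω)} := by
  rw [← measure_iUnion]
  · refine measure_mono (Set.iUnion_subset fun t ω hω => ⟨t, hω.1⟩)
  · have key : ∀ s t : ℕ, s < t → ∀ ω, draws A R a s ω = n → A s ω = a →
        draws A R a t ω ≠ n := by
      intro s t hst ω h1 h2 h3
      have := draws_mono (A := A) (R := R) a ω (Nat.succ_le_of_lt hst)
      simp only [Nat.succ_eq_add_one, draws_succ, h2, if_true] at this
      omega
    intro s t hst
    refine Set.disjoint_left.2 fun ω hs ht => ?_
    rcases lt_or_gt_of_ne hst with h | h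
    · exact key s t h ω hs.1.1 hs.2 ht.1.1
    · exact key t s h ω ht.1.1 ht.2 hs.1.1
  · intro t
    exact (measurableSet_history hTS.measurable_arm hTS.measurable_reward t
      (fun h => numDraws a h = n ∧ Q (numSuccesses a h))).inter
      (hTS.measurable_arm t (measurableSet_singleton a))

/-- After `n` draws of an arm its number of successes is binomial, except that the `n`-th draw may
never happen. -/
lemma measure_exists_state_le [IsProbabilityMeasure P] (hTS : IsThompsonSampling P μ θ A R)
    (a : Fin K) (h0 : 0 ≤ μ a) (h1 : μ a ≤ 1) (n k : ℕ) :
    P {ω | ∃ t, draws A R a t ω = n ∧ successes A R a t ω = k} ≤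
      ENNReal.ofReal (binomialProb n k (μ a)) := by
  induction n generalizing k with
  | zero =>
    rcases Nat.eq_zero_or_pos k with rfl | hk
    · simpa [binomialProb] using prob_le_one
    · have : {ω | ∃ t, draws A R a t ω = 0 ∧ successes A R a t ω = k} = ∅ := by
        refine Set.eq_empty_of_forall_notMem ?_
        rintro ω ⟨t, ht, hs⟩
        have : successes A R a t ω ≤ draws A R a t ω := numSuccesses_le_numDraws a _
        omega
      rw [this]; simp
  | succ n ih =>
    have hsub : {ω | ∃ t, draws A R a t ω = n + 1 ∧ successes A R a t ω = k} ⊆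
        (⋃ t, {ω | (draws A R a t ω = n ∧ successes A R a t ω = k) ∧ A t ω = a ∧
          R t ω = false}) ∪
        ⋃ t, {ω | (draws A R a t ω = n ∧ successes A R a t ω + 1 = k) ∧ A t ω = a ∧
          R t ω = true} := by
      rintro ω ⟨t, ht, hs⟩
      induction t with
      | zero => simp [draws_zero] at ht
      | succ t iht =>
        rw [draws_succ] at ht
        rw [successes_succ] at hs
        by_cases hA : A t ω = a
        · simp only [hA, if_true, true_and] at ht hs
          cases hR : R t ω with
          | false =>
            refine Or.inl (Set.mem_iUnion.2 ⟨t, ⟨by omega, ?_⟩, hA, hR⟩)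
            simpa [hR] using hs
          | true =>
            refine Or.inr (Set.mem_iUnion.2 ⟨t, ⟨by omega, ?_⟩, hA, hR⟩)
            simpa [hR] using hs
        · simp only [hA, if_false, false_and] at ht hs
          exact iht ht hs
    have hF : P (⋃ t, {ω | (draws A R a t ω = n ∧ successes A R a t ω = k) ∧ A t ω = a ∧
          R t ω = false}) ≤ ENNReal.ofReal (binomialProb n k (μ a) * (1 - μ a)) := by
      rw [ENNReal.ofReal_mul (binomialProb_nonneg h0 h1)]
      refine (measure_iUnion_le _).trans ?_
      calc _ = ∑' t, P {ω | (draws A R a t ω = n ∧ successes A R a t ω = k) ∧ A t ω = a} *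
            ENNReal.ofReal (1 - μ a) := tsum_congr fun t =>
              hTS.measure_reward_false a h0 t fun h => numDraws a h = n ∧ numSuccesses a h = k
        _ ≤ _ := by
          rw [ENNReal.tsum_mul_right]
          gcongr
          exact (hTS.tsum_measure_draw_le a n (· = k)).trans (ih k)
    have hT : ∀ Q : ℕ → Prop, P (⋃ t, {ω | (draws A R a t ω = n ∧ Q (successes A R a t ω)) ∧
          A t ω = a ∧ R t ω = true}) ≤
          P {ω | ∃ t, draws A R a t ω = n ∧ Q (successes A R a t ω)} *
            ENNReal.ofReal (μ a) := by
      intro Q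
      refine (measure_iUnion_le _).trans ?_
      calc _ = ∑' t, P {ω | (draws A R a t ω = n ∧ Q (successes A R a t ω)) ∧ A t ω = a} *
            ENNReal.ofReal (μ a) := tsum_congr fun t =>
              hTS.measure_reward_true a t fun h => numDraws a h = n ∧ Q (numSuccesses a h)
        _ ≤ _ := by
          rw [ENNReal.tsum_mul_right]
          gcongr
          exact hTS.tsum_measure_draw_le a n Q
    refine (measure_mono hsub).trans ((measure_union_le _ _).trans ?_)
    cases k with
    | zero =>
      have : P (⋃ t, {ω | (draws A R a t ω = n ∧ successes A R a t ω + 1 = 0) ∧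
          A t ω = a ∧ R t ω = true}) = 0 := by simp
      rw [this, add_zero]
      refine hF.trans_eq ?_
      congr 1
      simp only [binomialProb, Nat.choose_zero_right, Nat.sub_zero, pow_succ]; ring
    | succ k =>
      have h2 := (hT (· + 1 = k + 1)).trans (mul_le_mul_left (by simpa using ih k) _)
      refine (add_le_add hF h2).trans_eq ?_
      rw [← ENNReal.ofReal_mul (binomialProb_nonneg h0 h1), ← ENNReal.ofReal_add
        (mul_nonneg (binomialProb_nonneg h0 h1) (by linarith))
        (mul_nonneg (binomialProb_nonneg h0 h1) h0)]
      congr 1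
      rw [binomialProb, binomialProb, binomialProb, Nat.choose_succ_succ, Nat.add_sub_add_right]
      push_cast
      rcases lt_or_ge n (k + 1) with h | h
      · rw [Nat.choose_eq_zero_of_lt h]; push_cast; ring
      · obtain ⟨m, rfl⟩ := Nat.exists_eq_add_of_le h
        rw [Nat.add_sub_cancel_left, show k + 1 + m - k = m + 1 by omega]
        ring

lemma measure_exists_draws_eq_le [IsProbabilityMeasure P] (hTS : IsThompsonSampling P μ θ A R)
    (a : Fin K) (h0 : 0 ≤ μ a) (h1 : μ a ≤ 1) (n : ℕ) (Q : ℕ → Prop) [DecidablePred Q] :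
    P {ω | ∃ t, draws A R a t ω = n ∧ Q (successes A R a t ω)} ≤
      ENNReal.ofReal (∑ k ∈ Finset.range (n + 1) with Q k, binomialProb n k (μ a)) := by
  rw [ENNReal.ofReal_sum_of_nonneg fun k _ => binomialProb_nonneg h0 h1]
  refine le_trans ?_ (Finset.sum_le_sum fun k _ => hTS.measure_exists_state_le a h0 h1 n k)
  refine le_trans (measure_mono ?_) (measure_biUnion_finset_le _ _)
  rintro ω ⟨t, ht, hQ⟩
  have : successes A R a t ω ≤ draws A R a t ω := numSuccesses_le_numDraws a _
  simp only [Set.mem_iUnion, Finset.mem_filter, Finset.mem_range]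
  exact ⟨_, ⟨by omega, hQ⟩, t, ht, rfl⟩

end IsThompsonSampling

end Rounds

section Sampling

variable {K : ℕ} {Ω : Type*} {A : ℕ → Ω → Fin K} {R : ℕ → Ω → Bool}

/-! ### Draws in selected rounds -/

open Classical in
/-- The number of draws of the arm `a` in those of the first `T` rounds at whose start the history
satisfies the predicate `H`. -/
noncomputable def drawCount (A : ℕ → Ω → Fin K) (R : ℕ → Ω → Bool) (a : Fin K)
    (H : ∀ t, History K t → Prop) (T : ℕ) (ω : Ω) : ℝ :=
  ∑ t ∈ Finset.range T, if H t (history A R t ω) ∧ A t ω = a then 1 else 0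

lemma exists_drawCount_eq (a : Fin K) (H : ∀ t, History K t → Prop) (T : ℕ) :
    ∃ F : History K T → ℝ, ∀ ω, drawCount A R a H T ω = F (history A R T ω) := by
  classical
  induction T with
  | zero => exact ⟨fun _ => 0, fun ω => by simp [drawCount]⟩
  | succ T ih =>
    obtain ⟨F, hF⟩ := ih
    refine ⟨fun h => F (fun s => h s.castSucc) +
      if H T (fun s => h s.castSucc) ∧ (h (Fin.last T)).1 = a then 1 else 0, fun ω => ?_⟩
    rw [drawCount, Finset.sum_range_succ, ← drawCount, hF]
    rfl

variable [MeasurableSpace Ω] {P : Measure Ω} {μ : Fin K → ℝ} {θ : ℕ → Ω → Fin K → ℝ}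

/-! ### Conditional probabilities given the history -/

lemma isProbabilityMeasure_armPosterior {t : ℕ} (h : History K t) (a : Fin K) :
    IsProbabilityMeasure (betaMeasure ((numSuccesses a h : ℝ) + 1)
      ((numDraws a h : ℝ) - (numSuccesses a h : ℝ) + 1)) :=
  isProbabilityMeasure_posterior (numSuccesses_le_numDraws a h)

lemma armsPosterior_apply {t : ℕ} (h : History K t) (a : Fin K) {B : Set ℝ}
    (hB : MeasurableSet B) :
    armsPosterior h {x | x a ∈ B} = betaMeasure ((numSuccesses a h : ℝ) + 1)
      ((numDraws a h : ℝ) - (numSuccesses a h : ℝ) + 1) B := by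
  have := isProbabilityMeasure_armPosterior h
  exact (measurePreserving_eval (fun a : Fin K => betaMeasure ((numSuccesses a h : ℝ) + 1)
      ((numDraws a h : ℝ) - (numSuccesses a h : ℝ) + 1)) a).measure_preimage hB.nullMeasurableSet

lemma IsThompsonSampling.measure_sample_le [IsProbabilityMeasure P]
    (hTS : IsThompsonSampling P μ θ A R) (t : ℕ) (a : Fin K) (Q : History K t → Prop) {B : Set ℝ}
    (hB : MeasurableSet B) {c : ℝ} (hc : 0 ≤ c)
    (h : ∀ h, Q h → (betaMeasure ((numSuccesses a h : ℝ) + 1)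
      ((numDraws a h : ℝ) - (numSuccesses a h : ℝ) + 1)).real B ≤ c) :
    P.real {ω | Q (history A R t ω) ∧ θ t ω a ∈ B} ≤ c := by
  classical
  have hBa : MeasurableSet {x : Fin K → ℝ | x a ∈ B} := measurable_pi_apply a hB
  refine ENNReal.toReal_le_of_le_ofReal hc ?_
  have e1 := measure_history_eq_sum (P := P) hTS.measurable_arm hTS.measurable_reward t Q
    (hTS.measurable_sample t hBa)
  have e2 := measure_history_eq_sum (P := P) hTS.measurable_arm hTS.measurable_reward t Q
    MeasurableSet.univ
  calc P {ω | Q (history A R t ω) ∧ θ t ω a ∈ B}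
      = ∑ h with Q h, P {ω | history A R t ω = h} * armsPosterior h {x | x a ∈ B} :=
        e1.trans (Finset.sum_congr rfl fun h _ => hTS.sample_law t h _ hBa)
    _ ≤ ∑ h with Q h, P {ω | history A R t ω = h} * ENNReal.ofReal c := by
        refine Finset.sum_le_sum fun g hg => mul_le_mul_right ?_ _
        have := isProbabilityMeasure_armPosterior g a
        rw [armsPosterior_apply g a hB]
        exact (ENNReal.le_ofReal_iff_toReal_le (measure_ne_top _ _) hc).2
          (h g (Finset.mem_filter.1 hg).2)
    _ = P {ω | Q (history A R t ω)} * ENNReal.ofReal c := by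
        rw [← Finset.sum_mul]
        simp only [Set.mem_univ, and_true] at e2
        rw [e2]
    _ ≤ ENNReal.ofReal c := mul_le_of_le_one_left (zero_le) prob_le_one

/-- The conditional probability of drawing the arm `a` in round `t + 1`, given the history. -/
noncomputable def drawProb (P : Measure Ω) (A : ℕ → Ω → Fin K) (R : ℕ → Ω → Bool) (a : Fin K)
    (t : ℕ) (h : History K t) : ℝ :=
  (cond P {ω | history A R t ω = h}).real {ω | A t ω = a}

lemma drawProb_nonneg (a : Fin K) (t : ℕ) (h : History K t) : 0 ≤ drawProb P A R a t h :=
  measureReal_nonneg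

lemma measure_mul_drawProb [IsProbabilityMeasure P] (hA : ∀ t, Measurable (A t))
    (hR : ∀ t, Measurable (R t)) (a : Fin K) (t : ℕ) (h : History K t) :
    P.real {ω | history A R t ω = h} * drawProb P A R a t h =
      P.real {ω | history A R t ω = h ∧ A t ω = a} := by
  rw [drawProb, Measure.real, Measure.real, Measure.real, ← ENNReal.toReal_mul, mul_comm,
    cond_mul_eq_inter (measurableSet_history hA hR t (· = h))]
  rfl

lemma integrable_history [IsProbabilityMeasure P] (hA : ∀ t, Measurable (A t))
    (hR : ∀ t, Measurable (R t)) (t : ℕ) (f : History K t → Fin K → ℝ) :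
    Integrable (fun ω => f (history A R t ω) (A t ω)) P := by
  have hm : Measurable fun ω => (history A R t ω, A t ω) :=
    (measurable_history hA hR t).prodMk (hA t)
  have : IsProbabilityMeasure (P.map fun ω => (history A R t ω, A t ω)) :=
    Measure.isProbabilityMeasure_map hm.aemeasurable
  exact (Integrable.of_finite (f := fun x : History K t × Fin K => f x.1 x.2)
    (μ := P.map fun ω => (history A R t ω, A t ω))).comp_measurable hm

lemma integral_mul_indicator_draw [IsProbabilityMeasure P] (hA : ∀ t, Measurable (A t))
    (hR : ∀ t, Measurable (R t)) (a : Fin K) (t : ℕ) (f : History K t → ℝ) :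
    ∫ ω, f (history A R t ω) * (if A t ω = a then 1 else 0) ∂P =
      ∫ ω, f (history A R t ω) * drawProb P A R a t (history A R t ω) ∂P := by
  classical
  have hS := fun h => measurableSet_history hA hR t (· = h)
  have hSA : ∀ h, MeasurableSet {ω | history A R t ω = h ∧ A t ω = a} := fun h =>
    (hS h).inter (hA t (measurableSet_singleton a))
  have hint : ∀ (c : ℝ) (s : Set Ω), MeasurableSet s →
      Integrable (fun ω => c * s.indicator 1 ω) P := fun c s hs =>
    ((integrable_const (1 : ℝ)).indicator hs).const_mul c
  have e1 : ∀ ω, f (history A R t ω) * (if A t ω = a then 1 else 0) =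
      ∑ h, f h * ({ω | history A R t ω = h ∧ A t ω = a}.indicator 1 ω) := by
    intro ω
    rw [Finset.sum_eq_single (history A R t ω)]
    · simp [Set.indicator]
    · intro h _ hne
      simp [Set.indicator, Ne.symm hne]
    · simp
  have e2 : ∀ ω, f (history A R t ω) * drawProb P A R a t (history A R t ω) =
      ∑ h, f h * drawProb P A R a t h * ({ω | history A R t ω = h}.indicator 1 ω) := by
    intro ω
    rw [Finset.sum_eq_single (history A R t ω)]
    · simp [Set.indicator]
    · intro h _ hne
      simp [Set.indicator, Ne.symm hne]
    · simp
  simp_rw [e1, e2]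
  rw [integral_finsetSum _ fun h _ => hint _ _ (hSA h),
    integral_finsetSum _ fun h _ => hint _ _ (hS h)]
  refine Finset.sum_congr rfl fun h _ => ?_
  rw [integral_const_mul, integral_const_mul, integral_indicator_one (hS h),
    integral_indicator_one (hSA h), mul_assoc, mul_comm (drawProb P A R a t h),
    measure_mul_drawProb hA hR]

/-! ### Draws and their compensator -/

open Classical in
/-- The compensator of `drawCount`: draws are replaced by their conditional probabilities. -/
noncomputable def drawCompensator (P : Measure Ω) (A : ℕ → Ω → Fin K) (R : ℕ → Ω → Bool)
    (a : Fin K) (H : ∀ t, History K t → Prop) (T : ℕ) (ω : Ω) : ℝ :=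
  ∑ t ∈ Finset.range T,
    if H t (history A R t ω) then drawProb P A R a t (history A R t ω) else 0

lemma exists_drawCompensator_eq (a : Fin K) (H : ∀ t, History K t → Prop) (T : ℕ) :
    ∃ F : History K T → ℝ, ∀ ω, drawCompensator P A R a H T ω = F (history A R T ω) := by
  classical
  induction T with
  | zero => exact ⟨fun _ => 0, fun ω => by simp [drawCompensator]⟩
  | succ T ih =>
    obtain ⟨F, hF⟩ := ih
    refine ⟨fun h => F (fun s => h s.castSucc) + if H T (fun s => h s.castSucc) then
      drawProb P A R a T (fun s => h s.castSucc) else 0, fun ω => ?_⟩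
    rw [drawCompensator, Finset.sum_range_succ, ← drawCompensator, hF]
    rfl

lemma integrable_exp_compensator [IsProbabilityMeasure P] (hA : ∀ t, Measurable (A t))
    (hR : ∀ t, Measurable (R t)) (a : Fin K) (H : ∀ t, History K t → Prop) (c : ℝ) (T : ℕ) :
    Integrable (fun ω => Real.exp (c * drawCompensator P A R a H T ω - drawCount A R a H T ω))
      P := by
  obtain ⟨F, hF⟩ := exists_drawCount_eq (A := A) (R := R) a H T
  obtain ⟨G, hG⟩ := exists_drawCompensator_eq (P := P) (A := A) (R := R) a H T
  simp_rw [hF, hG]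
  exact integrable_history hA hR T fun h _ => Real.exp (c * G h - F h)

/-- The process `exp (c Λ - M)`, where `M` counts draws, `Λ` is its compensator and
`c = 1 - 1 / e`, is a supermartingale. -/
lemma integral_exp_compensator_le [IsProbabilityMeasure P] (hA : ∀ t, Measurable (A t))
    (hR : ∀ t, Measurable (R t)) (a : Fin K) (H : ∀ t, History K t → Prop) (T : ℕ) :
    ∫ ω, Real.exp ((1 - Real.exp (-1)) * drawCompensator P A R a H T ω -
      drawCount A R a H T ω) ∂P ≤ 1 := by
  classical
  set c := 1 - Real.exp (-1) with hc
  induction T with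
  | zero => simp [drawCount, drawCompensator]
  | succ T ih =>
    refine le_trans ?_ ih
    obtain ⟨F, hF⟩ := exists_drawCount_eq (A := A) (R := R) a H T
    obtain ⟨G, hG⟩ := exists_drawCompensator_eq (P := P) (A := A) (R := R) a H T
    set f : History K T → ℝ := fun h => Real.exp (c * G h - F h)
    set w : History K T → ℝ := fun h => if H T h then c else 0
    have hstep : ∀ ω, Real.exp (c * drawCompensator P A R a H (T + 1) ω -
        drawCount A R a H (T + 1) ω) =
        f (history A R T ω) * Real.exp (w (history A R T ω) *
          drawProb P A R a T (history A R T ω)) -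
        f (history A R T ω) * Real.exp (w (history A R T ω) *
          drawProb P A R a T (history A R T ω)) * w (history A R T ω) *
            (if A T ω = a then 1 else 0) := by
      intro ω
      rw [drawCompensator, drawCount, Finset.sum_range_succ, Finset.sum_range_succ,
        ← drawCompensator, ← drawCount, hF, hG]
      simp only [f, w]
      by_cases h1 : H T (history A R T ω)
      · by_cases h2 : A T ω = a
        · simp only [h1, h2, and_true, if_true, mul_one]
          rw [mul_add, add_sub_add_comm, Real.exp_add, sub_eq_add_neg (c * _) 1, Real.exp_add]
          have : c = 1 - Real.exp (-1) := hc
          linear_combination (Real.exp (c * G (history A R T ω) - F (history A R T ω)) *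
            Real.exp (c * drawProb P A R a T (history A R T ω))) * this
        · simp only [h1, h2, and_false, if_true, if_false, mul_zero, sub_zero, add_zero]
          rw [mul_add, add_sub_right_comm, Real.exp_add]
      · simp [h1]
    simp_rw [hstep]
    rw [integral_sub, integral_mul_indicator_draw hA hR a T fun h =>
      f h * Real.exp (w h * drawProb P A R a T h) * w h, ← integral_sub]
    · refine integral_mono (integrable_history hA hR T fun h _ =>
          f h * Real.exp (w h * drawProb P A R a T h) -
            f h * Real.exp (w h * drawProb P A R a T h) * w h * drawProb P A R a T h)
        (integrable_exp_compensator hA hR a H c T) fun ω => ?_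
      simp only [hF, hG]
      change _ ≤ f _
      set x := w (history A R T ω) * drawProb P A R a T (history A R T ω)
      have hx : Real.exp x * (1 - x) ≤ 1 := by
        have := mul_le_mul_of_nonneg_left (Real.one_sub_le_exp_neg x) (Real.exp_nonneg x)
        rwa [← Real.exp_add, add_neg_cancel, Real.exp_zero] at this
      have hf : 0 ≤ f (history A R T ω) := Real.exp_nonneg _
      calc _ = f (history A R T ω) * (Real.exp x * (1 - x)) := by simp only [x]; ring
        _ ≤ _ := mul_le_of_le_one_right hf hx
    · exact integrable_history hA hR T fun h _ => f h * Real.exp (w h * drawProb P A R a T h)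
    · exact integrable_history hA hR T fun h _ =>
        f h * Real.exp (w h * drawProb P A R a T h) * w h * drawProb P A R a T h
    · exact integrable_history hA hR T fun h _ => f h * Real.exp (w h * drawProb P A R a T h)
    · exact integrable_history hA hR T fun h b =>
        f h * Real.exp (w h * drawProb P A R a T h) * w h * (if b = a then 1 else 0)

/-- Few draws together with a large compensator are unlikely. -/
lemma measure_compensator_ge_le [IsProbabilityMeasure P] (hA : ∀ t, Measurable (A t))
    (hR : ∀ t, Measurable (R t)) (a : Fin K) (H : ∀ t, History K t → Prop) (T : ℕ) (m : ℝ)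
    {v : ℝ} (hv : 0 < v) :
    P.real {ω | drawCount A R a H T ω ≤ m ∧ v ≤ drawCompensator P A R a H T ω} ≤
      P.real {ω | ∃ t, H t (history A R t ω)} * Real.exp (m - (1 - Real.exp (-1)) * v) := by
  classical
  set c := 1 - Real.exp (-1) with hc
  have hc0 : 0 ≤ c := sub_nonneg.2 (Real.exp_le_one_iff.2 (by norm_num))
  set X : Ω → ℝ := fun ω => Real.exp (c * drawCompensator P A R a H T ω - drawCount A R a H T ω)
  set E := {ω | ∃ t, H t (history A R t ω)}
  set S := {ω | drawCount A R a H T ω ≤ m ∧ v ≤ drawCompensator P A R a H T ω}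
  have hE : MeasurableSet E := by
    have : E = ⋃ t, {ω | H t (history A R t ω)} := by ext ω; simp [E]
    rw [this]
    exact MeasurableSet.iUnion fun t => measurableSet_history hA hR t (H t)
  have hS : MeasurableSet S := by
    obtain ⟨F, hF⟩ := exists_drawCount_eq (A := A) (R := R) a H T
    obtain ⟨G, hG⟩ := exists_drawCompensator_eq (P := P) (A := A) (R := R) a H T
    simp only [S, hF, hG]
    exact measurableSet_history hA hR T fun h => F h ≤ m ∧ v ≤ G h
  have hX : Integrable X P := integrable_exp_compensator hA hR a H c T
  -- outside `E` both processes vanish, so that all the mass of `X` in excess of `1` is on `E`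
  have h1 : ∫ ω in Eᶜ, X ω ∂P = P.real Eᶜ := by
    have : ∫ ω in Eᶜ, X ω ∂P = ∫ ω in Eᶜ, (1 : ℝ) ∂P := by
      refine setIntegral_congr_fun hE.compl fun ω hω => ?_
      have hω : ∀ t, ¬ H t (history A R t ω) := by simpa [E] using hω
      simp [X, drawCount, drawCompensator, hω]
    rw [this]; simp
  have h2 : ∫ ω in E, X ω ∂P ≤ P.real E := by
    have h3 := integral_add_compl hE hX
    have h4 : ∫ ω, X ω ∂P ≤ 1 := integral_exp_compensator_le hA hR a H T
    rw [h1, probReal_compl_eq_one_sub hE] at h3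
    linarith
  have hSE : S ⊆ E := by
    intro ω hω
    by_contra hne
    have hne : ∀ t, ¬ H t (history A R t ω) := by simpa [E] using hne
    have : v ≤ 0 := by simpa [drawCompensator, hne] using hω.2
    linarith
  have h5 : P.real S * Real.exp (c * v - m) ≤ ∫ ω in E, X ω ∂P := by
    calc P.real S * Real.exp (c * v - m) = ∫ ω in S, Real.exp (c * v - m) ∂P := by simp
      _ ≤ ∫ ω in S, X ω ∂P := by
          refine setIntegral_mono_on (integrableOn_const (measure_ne_top _ _)) hX.integrableOn hS
            fun ω hω => Real.exp_le_exp.2 ?_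
          have := mul_le_mul_of_nonneg_left hω.2 hc0
          linarith [hω.1]
      _ ≤ ∫ ω in E, X ω ∂P := setIntegral_mono_set hX.integrableOn
          (Eventually.of_forall fun ω => Real.exp_nonneg _) hSE.eventuallyLE
  have h6 : Real.exp (m - c * v) = (Real.exp (c * v - m))⁻¹ := by
    rw [← Real.exp_neg, neg_sub]
  rw [h6, ← div_eq_mul_inv, le_div_iff₀ (Real.exp_pos _)]
  exact h5.trans h2

/-- In every round, either the optimal arm has a conditional probability of being drawn that is
comparable to the posterior tail of its samples beyond `y`, or another arm is drawn because of a
sample that exceeds `y`. The latter is bounded by the probability of drawing that arm or by its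
posterior tail, as the predicate `U` prescribes. -/
lemma IsThompsonSampling.one_le_sum_drawProb [IsProbabilityMeasure P]
    (hTS : IsThompsonSampling P μ θ A R) (i : Fin K) (t : ℕ) (h : History K t)
    (hh : P {ω | history A R t ω = h} ≠ 0) {y : ℝ} (hy : 0 < y) (hy1 : y < 1)
    (U : Fin K → Prop) [DecidablePred U] :
    1 ≤ drawProb P A R i t h * (2 / posteriorTail (numDraws i h) (numSuccesses i h) y) +
      ∑ a ∈ Finset.univ.erase i, if U a then drawProb P A R a t h else
        posteriorTail (numDraws a h) (numSuccesses a h) y := by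
  classical
  set S := {ω | history A R t ω = h}
  have hS : MeasurableSet S :=
    measurableSet_history hTS.measurable_arm hTS.measurable_reward t (· = h)
  set ν := cond P S
  have hν : IsProbabilityMeasure ν := cond_isProbabilityMeasure hh
  have hpost := isProbabilityMeasure_armPosterior h
  have hlaw : ∀ B : Set (Fin K → ℝ), MeasurableSet B →
      ν {ω | θ t ω ∈ B} = armsPosterior h B := by
    intro B hB
    have : P (S ∩ {ω | θ t ω ∈ B}) = P S * armsPosterior h B := hTS.sample_law t h B hB
    rw [cond_apply hS, this, ← mul_assoc, ENNReal.inv_mul_cancel hh (measure_ne_top _ _), one_mul]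
  have hmax : ∀ᵐ ω ∂ν, ∀ a, θ t ω a ≤ θ t ω (A t ω) :=
    cond_absolutelyContinuous (hTS.arm_argmax t)
  have htail : ∀ a, ν.real {ω | y < θ t ω a} =
      posteriorTail (numDraws a h) (numSuccesses a h) y := by
    intro a
    have hB : MeasurableSet {x : Fin K → ℝ | x a ∈ Set.Ioi y} :=
      measurable_pi_apply a measurableSet_Ioi
    rw [Measure.real, posteriorTail, Measure.real, ← armsPosterior_apply h a measurableSet_Ioi,
      ← hlaw _ hB]
    rfl
  set p := posteriorTail (numDraws i h) (numSuccesses i h) y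
  have hp0 : 0 < p := posteriorTail_pos (numSuccesses_le_numDraws i h) hy hy1
  have hp1 : p ≤ 1 := posteriorTail_le_one (numSuccesses_le_numDraws i h) y
  set q := ν.real {ω | ∀ a, a ≠ i → θ t ω a ≤ y}
  -- by independence, arm `i` is drawn with probability at least `p * q`
  have hpq : p * q ≤ drawProb P A R i t h := by
    have hbox : ∀ s : Fin K → Set ℝ, (∀ a, MeasurableSet (s a)) →
        ν.real {ω | ∀ a, θ t ω a ∈ s a} = ∏ a, (betaMeasure ((numSuccesses a h : ℝ) + 1)
          ((numDraws a h : ℝ) - (numSuccesses a h : ℝ) + 1)).real (s a) := by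
      intro s hs
      have e : {ω | ∀ a, θ t ω a ∈ s a} = {ω | θ t ω ∈ Set.univ.pi s} := by
        ext ω; simp [Set.mem_pi]
      rw [e, Measure.real, hlaw _ (MeasurableSet.univ_pi hs), armsPosterior, Measure.pi_pi,
        ENNReal.toReal_prod]
      rfl
    have e1 : q = ∏ a ∈ Finset.univ.erase i, (betaMeasure ((numSuccesses a h : ℝ) + 1)
          ((numDraws a h : ℝ) - (numSuccesses a h : ℝ) + 1)).real (Set.Iic y) := by
      have h1 := hbox (fun a => if a = i then Set.univ else Set.Iic y) fun a => by
        split_ifs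
        exacts [MeasurableSet.univ, measurableSet_Iic]
      rw [← Finset.mul_prod_erase _ _ (Finset.mem_univ i)] at h1
      simp only [if_true, probReal_univ, one_mul] at h1
      have h2 : {ω | ∀ a, θ t ω a ∈ if a = i then Set.univ else Set.Iic y} =
          {ω | ∀ a, a ≠ i → θ t ω a ≤ y} := by
        ext ω
        refine forall_congr' fun a => ?_
        by_cases ha : a = i <;> simp [ha]
      rw [h2] at h1
      refine h1.trans (Finset.prod_congr rfl fun a ha => ?_)
      rw [if_neg (Finset.ne_of_mem_erase ha)]
    have e2 : ν.real {ω | ∀ a, θ t ω a ∈ if a = i then Set.Ioi y else Set.Iic y} = p * q := by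
      rw [hbox _ fun a => by split_ifs; exacts [measurableSet_Ioi, measurableSet_Iic],
        ← Finset.mul_prod_erase _ _ (Finset.mem_univ i), e1]
      simp only [if_true]
      congr 1
      exact Finset.prod_congr rfl fun a ha => by rw [if_neg (Finset.ne_of_mem_erase ha)]
    rw [← e2]
    refine ENNReal.toReal_mono (measure_ne_top _ _) (measure_mono_ae ?_)
    filter_upwards [hmax] with ω hω hbox
    by_contra hne
    have h1 : θ t ω i ∈ Set.Ioi y := by
      have := hbox i
      rwa [if_pos rfl] at this
    have h2 : θ t ω (A t ω) ∈ Set.Iic y := by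
      have := hbox (A t ω)
      rwa [if_neg (show ¬ A t ω = i from hne)] at this
    exact absurd ((hω i).trans h2) (not_le.2 h1)
  have hcover : ν.real Set.univ ≤ ν.real ({ω | A t ω = i} ∪
      {ω | ∀ a, a ≠ i → θ t ω a ≤ y} ∪
      ⋃ a ∈ Finset.univ.erase i, {ω | A t ω = a ∧ y < θ t ω a}) := by
    refine ENNReal.toReal_mono (measure_ne_top _ _) (measure_mono_ae ?_)
    filter_upwards [hmax] with ω hω _
    by_cases h1 : A t ω = i
    · exact Or.inl (Or.inl h1)
    · by_cases h2 : y < θ t ω (A t ω)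
      · exact Or.inr (Set.mem_biUnion (Finset.mem_coe.2 (by simpa using h1)) ⟨rfl, h2⟩)
      · exact Or.inl (Or.inr fun a _ => (hω a).trans (not_lt.1 h2))
  rw [probReal_univ] at hcover
  have hsum : ν.real (⋃ a ∈ Finset.univ.erase i, {ω | A t ω = a ∧ y < θ t ω a}) ≤
      ∑ a ∈ Finset.univ.erase i, if U a then drawProb P A R a t h else
        posteriorTail (numDraws a h) (numSuccesses a h) y := by
    refine (measureReal_biUnion_finset_le _ _).trans (Finset.sum_le_sum fun a _ => ?_)
    split_ifs
    · exact measureReal_mono fun ω hω => hω.1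
    · rw [← htail a]
      exact measureReal_mono fun ω hω => hω.2
  have hq : drawProb P A R i t h + q ≤ drawProb P A R i t h * (2 / p) := by
    have h1 : q ≤ drawProb P A R i t h / p := by
      rw [le_div_iff₀ hp0]; linarith
    have h2 : drawProb P A R i t h ≤ drawProb P A R i t h / p :=
      le_div_self (drawProb_nonneg _ _ _) hp0 hp1
    calc _ ≤ drawProb P A R i t h / p + drawProb P A R i t h / p := add_le_add h2 h1
      _ = _ := by ring
  have h3 := measureReal_union_le (μ := ν) ({ω | A t ω = i} ∪ {ω | ∀ a, a ≠ i → θ t ω a ≤ y})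
    (⋃ a ∈ Finset.univ.erase i, {ω | A t ω = a ∧ y < θ t ω a})
  have h4 := measureReal_union_le (μ := ν) {ω | A t ω = i} {ω | ∀ a, a ≠ i → θ t ω a ≤ y}
  have h5 : ν.real {ω | A t ω = i} = drawProb P A R i t h := rfl
  linarith

end Sampling

section FewDraws

variable {K : ℕ} {Ω : Type*} {A : ℕ → Ω → Fin K} {R : ℕ → Ω → Bool}

/-! ### The optimal arm is drawn often -/

/-- The `n + 1`-st draw of an arm happens at most once. -/
lemma sum_draws_eq_le_one (a : Fin K) (n T : ℕ) (ω : Ω) :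
    ∑ t ∈ Finset.range T, (if draws A R a t ω = n ∧ A t ω = a then (1 : ℝ) else 0) ≤ 1 := by
  have : ∑ t ∈ Finset.range T, (if draws A R a t ω = n ∧ A t ω = a then (1 : ℝ) else 0) =
      if n < draws A R a T ω then 1 else 0 := by
    induction T with
    | zero => simp [draws_zero]
    | succ T ih =>
      rw [Finset.sum_range_succ, ih, draws_succ]
      by_cases h1 : A T ω = a
      · rcases lt_trichotomy n (draws A R a T ω) with h | h | h
        · rw [if_pos h, if_neg (by omega), if_pos (by omega), add_zero]
        · rw [if_neg (by omega), if_pos ⟨h.symm, h1⟩, if_pos (by rw [if_pos h1]; omega), zero_add]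
        · rw [if_neg (by omega), if_neg (by omega), if_neg (by rw [if_pos h1]; omega), add_zero]
      · have h2 : ¬ (draws A R a T ω = n ∧ A T ω = a) := fun h => h1 h.2
        rw [if_neg h2, if_neg h1, add_zero, add_zero]
  rw [this]
  split_ifs <;> norm_num

variable [MeasurableSpace Ω] {P : Measure Ω} {μ : Fin K → ℝ} {θ : ℕ → Ω → Fin K → ℝ}

/-- A geometric bound on deviations of the empirical mean after `n` draws gives a geometric bound
on deviations at any time after `L` draws. -/
lemma IsThompsonSampling.measure_exists_deviation_le [IsProbabilityMeasure P]
    (hTS : IsThompsonSampling P μ θ A R) (a : Fin K) (h0 : 0 ≤ μ a) (h1 : μ a ≤ 1)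
    (Q : ℕ → ℕ → Prop) [∀ n, DecidablePred (Q n)] {ρ : ℝ} (hρ0 : 0 ≤ ρ) (hρ1 : ρ < 1)
    (hQ : ∀ n, ∑ k ∈ Finset.range (n + 1) with Q n k, binomialProb n k (μ a) ≤ ρ ^ n) (L : ℕ) :
    P.real {ω | ∃ t, L ≤ draws A R a t ω ∧ Q (draws A R a t ω) (successes A R a t ω)} ≤
      ρ ^ L / (1 - ρ) := by
  have h1ρ : 0 < 1 - ρ := by linarith
  refine ENNReal.toReal_le_of_le_ofReal (by positivity) ?_
  have hsub : {ω | ∃ t, L ≤ draws A R a t ω ∧ Q (draws A R a t ω) (successes A R a t ω)} ⊆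
      ⋃ n : ℕ, {ω | ∃ t, draws A R a t ω = n + L ∧ Q (n + L) (successes A R a t ω)} := by
    rintro ω ⟨t, hL, hq⟩
    refine Set.mem_iUnion.2 ⟨draws A R a t ω - L, t, by omega, ?_⟩
    rwa [Nat.sub_add_cancel hL]
  have hsum : HasSum (fun n : ℕ => ρ ^ (n + L)) (ρ ^ L / (1 - ρ)) := by
    have := (hasSum_geometric_of_lt_one hρ0 hρ1).mul_right (ρ ^ L)
    simp_rw [pow_add]
    rwa [← div_eq_inv_mul] at this
  calc _ ≤ ∑' n : ℕ, P {ω | ∃ t, draws A R a t ω = n + L ∧ Q (n + L) (successes A R a t ω)} :=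
        (measure_mono hsub).trans (measure_iUnion_le _)
    _ ≤ ∑' n : ℕ, ENNReal.ofReal (ρ ^ (n + L)) := by
        refine ENNReal.tsum_le_tsum fun n => ?_
        exact (hTS.measure_exists_draws_eq_le a h0 h1 (n + L) (Q (n + L))).trans
          (ENNReal.ofReal_le_ofReal (hQ _))
    _ = ENNReal.ofReal (ρ ^ L / (1 - ρ)) := by
        rw [← hsum.tsum_eq, ENNReal.ofReal_tsum_of_nonneg (fun n => by positivity) hsum.summable]

/-- An arm is unsettled while it has been drawn fewer than `L` times or has an empirical mean
above `x`. The compensator of its draws in such rounds is rarely much larger than `L`. -/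
lemma IsThompsonSampling.measure_unsettled_ge_le [IsProbabilityMeasure P]
    (hTS : IsThompsonSampling P μ θ A R) (a : Fin K) (h0 : 0 ≤ μ a) {m x : ℝ} (hm : μ a ≤ m)
    (hmx : m < x) (hx : x ≤ 1) (L T : ℕ) {v : ℝ} (hv : 0 < v) :
    P.real {ω | v ≤ drawCompensator P A R a
      (fun _ h => numDraws a h < L ∨ x * numDraws a h < numSuccesses a h) T ω} ≤
      Real.exp (-((x - m) ^ 2 / 4)) ^ L / (1 - Real.exp (-((x - m) ^ 2 / 4))) +
        Real.exp (L - (1 - Real.exp (-1)) * v) := by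
  classical
  set H : ∀ t, History K t → Prop :=
    fun _ h => numDraws a h < L ∨ x * numDraws a h < numSuccesses a h
  have hρ1 : Real.exp (-((x - m) ^ 2 / 4)) < 1 := by
    rw [Real.exp_lt_one_iff]
    have : 0 < x - m := by linarith
    have : 0 < (x - m) ^ 2 / 4 := by positivity
    linarith
  have hdev := hTS.measure_exists_deviation_le a h0 (by linarith)
    (fun n k => x * (n : ℝ) < (k : ℝ)) (Real.exp_nonneg _) hρ1
    (fun n => sum_binomialProb_gt_le n h0 hm hmx hx) L
  refine le_trans (measureReal_mono ?_) ((measureReal_union_le _ _).trans (add_le_add hdev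
    ((measure_compensator_ge_le hTS.measurable_arm hTS.measurable_reward a H T L hv).trans
      (mul_le_of_le_one_left (Real.exp_nonneg _) measureReal_le_one))))
  intro ω hω
  by_cases h : ∃ t, L ≤ draws A R a t ω ∧
      x * (draws A R a t ω : ℝ) < (successes A R a t ω : ℝ)
  · exact Or.inl h
  · refine Or.inr ⟨?_, hω⟩
    push Not at h
    refine le_trans (Finset.sum_le_sum fun t _ => ?_) (sum_draws_lt_le (A := A) (R := R) a L T ω)
    by_cases h1 : H t (history A R t ω) ∧ A t ω = a
    · have h2 : draws A R a t ω < L := by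
        by_contra hL
        rcases h1.1 with h2 | h2
        · exact hL h2
        · exact absurd h2 (not_lt.2 (h t (not_lt.1 hL)))
      rw [if_pos h1, if_pos ⟨h1.2, h2⟩]
    · rw [if_neg h1]
      split_ifs <;> norm_num

/-- While an arm stays in the state of `n` draws and `k` successes, the compensator of its draws
has exponential tails. -/
lemma IsThompsonSampling.measure_state_ge_le [IsProbabilityMeasure P]
    (hTS : IsThompsonSampling P μ θ A R) (a : Fin K) (h0 : 0 ≤ μ a) (h1 : μ a ≤ 1) (n k T : ℕ)
    {v : ℝ} (hv : 0 < v) :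
    P.real {ω | v ≤ drawCompensator P A R a
      (fun _ h => numDraws a h = n ∧ numSuccesses a h = k) T ω} ≤
      binomialProb n k (μ a) * Real.exp (1 - (1 - Real.exp (-1)) * v) := by
  classical
  set H : ∀ t, History K t → Prop := fun _ h => numDraws a h = n ∧ numSuccesses a h = k
  have h2 := measure_compensator_ge_le (P := P) hTS.measurable_arm hTS.measurable_reward a H T 1 hv
  have h3 : P.real {ω | ∃ t, H t (history A R t ω)} ≤ binomialProb n k (μ a) :=
    ENNReal.toReal_le_of_le_ofReal (binomialProb_nonneg h0 h1)
      (hTS.measure_exists_state_le a h0 h1 n k)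
  refine le_trans (measureReal_mono ?_)
    (h2.trans (mul_le_mul_of_nonneg_right h3 (Real.exp_nonneg _)))
  refine fun ω hω => ⟨?_, hω⟩
  refine le_trans (Finset.sum_le_sum fun t _ => ?_) (sum_draws_eq_le_one (A := A) (R := R) a n T ω)
  by_cases h1 : H t (history A R t ω) ∧ A t ω = a
  · rw [if_pos h1, if_pos ⟨h1.1.1, h1.2⟩]
  · rw [if_neg h1]
    split_ifs <;> norm_num

/-- The states `(j, k)` of an arm drawn `j ≤ n` times with `k` successes. -/
def states (n : ℕ) : Finset (ℕ × ℕ) :=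
  (Finset.range (n + 1) ×ˢ Finset.range (n + 1)).filter fun s => s.2 ≤ s.1

lemma card_states_le (n : ℕ) : ((states n).card : ℝ) ≤ ((n : ℝ) + 1) ^ 2 := by
  have : (states n).card ≤ (n + 1) * (n + 1) := by
    refine (Finset.card_filter_le _ _).trans_eq ?_
    rw [Finset.card_product, Finset.card_range]
  calc ((states n).card : ℝ) ≤ ((n + 1) * (n + 1) : ℕ) := by exact_mod_cast this
    _ = _ := by push_cast; ring

/-- The bound of `IsThompsonSampling.one_le_sum_drawProb`, with the state of the optimal arm
written as a sum over states and the settled arms contributing a constant. -/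
lemma IsThompsonSampling.one_le_sum_states [IsProbabilityMeasure P]
    (hTS : IsThompsonSampling P μ θ A R) (i : Fin K) (t : ℕ) (h : History K t)
    (hh : P {ω | history A R t ω = h} ≠ 0) {x y : ℝ} (hx : 0 < x) (hxy : x ≤ y) (hy1 : y < 1)
    {L n : ℕ} (hn : numDraws i h ≤ n)
    (hL : ∀ m : ℕ, L ≤ m → (m + 1) * Real.exp (-(m * bernKL x y)) ≤ 1 / (4 * K))
    (U : Fin K → Prop) [DecidablePred U]
    (hU : ∀ a, ¬ U a → L ≤ numDraws a h ∧ (numSuccesses a h : ℝ) ≤ x * numDraws a h)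
    (H : ℕ × ℕ → Prop) [DecidablePred H] (hH : H (numDraws i h, numSuccesses i h)) :
    1 ≤ ∑ s ∈ states n, 2 / posteriorTail s.1 s.2 y *
        (if H s then drawProb P A R i t h else 0) +
      ∑ a ∈ Finset.univ.erase i, ((if U a then drawProb P A R a t h else 0) + 1 / (4 * K)) := by
  have hy : 0 < y := hx.trans_le hxy
  refine (hTS.one_le_sum_drawProb i t h hh hy hy1 U).trans
    (add_le_add ?_ (Finset.sum_le_sum fun a _ => ?_))
  · have hmem : (numDraws i h, numSuccesses i h) ∈ states n := by
      have h1 := numSuccesses_le_numDraws i h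
      simp only [states, Finset.mem_filter, Finset.mem_product, Finset.mem_range]
      omega
    refine le_trans (le_of_eq ?_) (Finset.single_le_sum
      (f := fun s : ℕ × ℕ => 2 / posteriorTail s.1 s.2 y *
        (if H s then drawProb P A R i t h else 0)) (fun s _ => mul_nonneg
      (div_nonneg zero_le_two measureReal_nonneg) ?_) hmem)
    · simp only [if_pos hH]
      rw [mul_comm]
    · split_ifs
      exacts [drawProb_nonneg _ _ _, le_rfl]
  · by_cases hUa : U a
    · rw [if_pos hUa, if_pos hUa]
      have : 0 ≤ 1 / (4 * (K : ℝ)) := by positivity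
      linarith
    · rw [if_neg hUa, if_neg hUa, zero_add]
      exact (posteriorTail_le_exp (numSuccesses_le_numDraws a _) hx hxy (hU a hUa).2).trans
        (hL _ (hU a hUa).1)

/-- If the optimal arm `i` is drawn at most `n` times in `T` rounds, then the `T` rounds are paid
for by a large compensator, either of another arm while it is unsettled, or of arm `i` in one of
its states. -/
lemma IsThompsonSampling.ae_large_compensator [IsProbabilityMeasure P]
    (hTS : IsThompsonSampling P μ θ A R) (i : Fin K) {x y : ℝ} (hx : 0 < x) (hxy : x ≤ y)
    (hy1 : y < 1) {L T : ℕ} (n : ℕ) (hT : 0 < T)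
    (hL : ∀ m : ℕ, L ≤ m → (m + 1) * Real.exp (-(m * bernKL x y)) ≤ 1 / (4 * K)) :
    ∀ᵐ ω ∂P, draws A R i T ω ≤ n →
      (∃ a ∈ Finset.univ.erase i, T / (4 * K : ℝ) ≤ drawCompensator P A R a
        (fun _ h => numDraws a h < L ∨ x * numDraws a h < numSuccesses a h) T ω) ∨
      ∃ s ∈ states n, posteriorTail s.1 s.2 y * (T / (4 * ((n : ℝ) + 1) ^ 2)) ≤
        drawCompensator P A R i (fun _ h => numDraws i h = s.1 ∧ numSuccesses i h = s.2) T ω := by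
  classical
  have hy : 0 < y := hx.trans_le hxy
  have hne : ∀ᵐ ω ∂P, ∀ t, P {ω' | history A R t ω' = history A R t ω} ≠ 0 := by
    refine ae_all_iff.2 fun t => ?_
    have : {ω | ¬ P {ω' | history A R t ω' = history A R t ω} ≠ 0} ⊆
        ⋃ h ∈ (Finset.univ.filter fun h : History K t => P {ω | history A R t ω = h} = 0),
          {ω | history A R t ω = h} := by
      intro ω hω
      simp only [Set.mem_iUnion, Finset.mem_filter, Finset.mem_univ, true_and]
      exact ⟨history A R t ω, not_not.1 hω, rfl⟩
    refine measure_mono_null this ((measure_biUnion_null_iff (Finset.countable_toSet _)).2 ?_)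
    exact fun h hh => (Finset.mem_filter.1 hh).2
  filter_upwards [hne] with ω hω hn
  by_contra hcon
  push Not at hcon
  obtain ⟨hcon1, hcon2⟩ := hcon
  have hK : 0 < K := i.pos
  have hKr : (0 : ℝ) < K := by exact_mod_cast hK
  have hTr : (0 : ℝ) < T := by exact_mod_cast hT
  obtain ⟨U, hU⟩ : ∃ U : ∀ a : Fin K, ∀ t, History K t → Prop, ∀ a, U a =
    fun _ h => numDraws a h < L ∨ x * numDraws a h < numSuccesses a h := ⟨_, fun _ => rfl⟩
  obtain ⟨H, hH⟩ : ∃ H : ℕ × ℕ → ∀ t, History K t → Prop, ∀ s, H s =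
    fun _ h => numDraws i h = s.1 ∧ numSuccesses i h = s.2 := ⟨_, fun _ => rfl⟩
  simp only [← hU, ← hH] at hcon1 hcon2
  have hround : ∀ t ∈ Finset.range T, (1 : ℝ) ≤
      ∑ s ∈ states n, 2 / posteriorTail s.1 s.2 y *
        (if H s t (history A R t ω) then drawProb P A R i t (history A R t ω) else 0) +
      ∑ a ∈ Finset.univ.erase i, ((if U a t (history A R t ω) then
        drawProb P A R a t (history A R t ω) else 0) + 1 / (4 * K)) := by
    intro t ht
    have hle : numDraws i (history A R t ω) ≤ n :=
      (draws_mono (A := A) (R := R) i ω (Finset.mem_range.1 ht).le).trans hn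
    refine hTS.one_le_sum_states i t _ (hω t) hx hxy hy1 hle hL (fun a => U a t _) (fun a ha => ?_)
      (fun s => H s t _) (by simp [hH])
    rw [hU] at ha
    obtain ⟨h1, h2⟩ := not_or.1 ha
    exact ⟨not_lt.1 h1, not_lt.1 h2⟩
  have hsum := Finset.sum_le_sum hround
  rw [Finset.sum_add_distrib, Finset.sum_comm, Finset.sum_comm (t := Finset.univ.erase i)] at hsum
  simp only [Finset.sum_add_distrib, ← Finset.mul_sum, Finset.sum_const, Finset.card_range,
    nsmul_eq_mul, mul_one] at hsum
  have hcard : (((Finset.univ.erase i : Finset (Fin K)).card : ℝ)) ≤ K - 1 := by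
    rw [Finset.card_erase_of_mem (Finset.mem_univ i), Finset.card_univ, Fintype.card_fin,
      Nat.cast_sub hK, Nat.cast_one]
  have hb1 : ∑ s ∈ states n, 2 / posteriorTail s.1 s.2 y *
      ∑ t ∈ Finset.range T, (if H s t (history A R t ω) then
        drawProb P A R i t (history A R t ω) else 0) ≤ T / 2 := by
    calc _ ≤ ∑ s ∈ states n, (T / (2 * ((n : ℝ) + 1) ^ 2)) := by
          refine Finset.sum_le_sum fun s hs => ?_
          have hpos : 0 < posteriorTail s.1 s.2 y :=
            posteriorTail_pos (Finset.mem_filter.1 hs).2 hy hy1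
          have h1 := mul_le_mul_of_nonneg_left (hcon2 s hs).le
            (div_nonneg zero_le_two hpos.le : 0 ≤ 2 / posteriorTail s.1 s.2 y)
          refine h1.trans_eq ?_
          field_simp
          norm_num
      _ ≤ ((n : ℝ) + 1) ^ 2 * (T / (2 * ((n : ℝ) + 1) ^ 2)) := by
          rw [Finset.sum_const, nsmul_eq_mul]
          exact mul_le_mul_of_nonneg_right (card_states_le n) (by positivity)
      _ = T / 2 := by field_simp
  have hb2 : ∑ a ∈ Finset.univ.erase i, ∑ t ∈ Finset.range T, (if U a t (history A R t ω) then
        drawProb P A R a t (history A R t ω) else 0) ≤ (K - 1) * (T / (4 * K)) := by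
    refine (Finset.sum_le_sum fun a ha => (hcon1 a ha).le).trans ?_
    rw [Finset.sum_const, nsmul_eq_mul]
    exact mul_le_mul_of_nonneg_right hcard (by positivity)
  have hb3 : ((Finset.univ.erase i : Finset (Fin K)).card : ℝ) * (T * (1 / (4 * K))) ≤
      (K - 1) * (T / (4 * K)) := by
    rw [mul_one_div]
    exact mul_le_mul_of_nonneg_right hcard (by positivity)
  have hb4 : ((K : ℝ) - 1) * (T / (4 * K)) < T / 4 := by
    calc ((K : ℝ) - 1) * (T / (4 * K)) < K * (T / (4 * K)) :=
          mul_lt_mul_of_pos_right (by linarith) (by positivity)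
      _ = T / 4 := by field_simp
  linarith

/-- The union bound over the alternatives of `IsThompsonSampling.ae_large_compensator`. -/
lemma IsThompsonSampling.measure_draws_le_le [IsProbabilityMeasure P]
    (hTS : IsThompsonSampling P μ θ A R) (i : Fin K) (hi0 : 0 ≤ μ i) (hi1 : μ i ≤ 1) {m x y : ℝ}
    (hμ : ∀ a, a ≠ i → 0 ≤ μ a ∧ μ a ≤ m) (hmx : m < x) (hx : 0 < x) (hxy : x ≤ y)
    (hy1 : y < 1) {L T : ℕ} (n : ℕ) (hT : 0 < T)
    (hL : ∀ m : ℕ, L ≤ m → (m + 1) * Real.exp (-(m * bernKL x y)) ≤ 1 / (4 * K)) :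
    P.real {ω | draws A R i T ω ≤ n} ≤
      K * (Real.exp (-((x - m) ^ 2 / 4)) ^ L / (1 - Real.exp (-((x - m) ^ 2 / 4))) +
        Real.exp (L - (1 - Real.exp (-1)) * (T / (4 * K)))) +
      ∑ s ∈ states n, binomialProb s.1 s.2 (μ i) * Real.exp (1 - (1 - Real.exp (-1)) *
        (posteriorTail s.1 s.2 y * (T / (4 * ((n : ℝ) + 1) ^ 2)))) := by
  have hK : 0 < K := i.pos
  have hKr : (0 : ℝ) < K := by exact_mod_cast hK
  have hTr : (0 : ℝ) < T := by exact_mod_cast hT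
  set E : Fin K → Set Ω := fun a => {ω | T / (4 * K : ℝ) ≤ drawCompensator P A R a
    (fun _ h => numDraws a h < L ∨ x * numDraws a h < numSuccesses a h) T ω}
  set F : ℕ × ℕ → Set Ω := fun s => {ω | posteriorTail s.1 s.2 y *
    (T / (4 * ((n : ℝ) + 1) ^ 2)) ≤ drawCompensator P A R i
      (fun _ h => numDraws i h = s.1 ∧ numSuccesses i h = s.2) T ω}
  have hsub : P.real {ω | draws A R i T ω ≤ n} ≤
      P.real ((⋃ a ∈ Finset.univ.erase i, E a) ∪ ⋃ s ∈ states n, F s) := by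
    refine ENNReal.toReal_mono (measure_ne_top _ _) (measure_mono_ae ?_)
    filter_upwards [hTS.ae_large_compensator i hx hxy hy1 n hT hL] with ω hω hn
    rcases hω hn with ⟨a, ha, h⟩ | ⟨s, hs, h⟩
    · exact Or.inl (Set.mem_biUnion (Finset.mem_coe.2 ha) h)
    · exact Or.inr (Set.mem_biUnion (Finset.mem_coe.2 hs) h)
  refine hsub.trans ((measureReal_union_le _ _).trans (add_le_add
    ((measureReal_biUnion_finset_le _ _).trans ?_)
    ((measureReal_biUnion_finset_le _ _).trans (Finset.sum_le_sum fun s hs => ?_))))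
  · set B := Real.exp (-((x - m) ^ 2 / 4)) ^ L / (1 - Real.exp (-((x - m) ^ 2 / 4))) +
        Real.exp (L - (1 - Real.exp (-1)) * (T / (4 * K)))
    have hB : 0 ≤ B := by
      have : Real.exp (-((x - m) ^ 2 / 4)) ≤ 1 := by
        rw [Real.exp_le_one_iff]
        have : 0 ≤ (x - m) ^ 2 / 4 := by positivity
        linarith
      exact add_nonneg (div_nonneg (by positivity) (by linarith)) (Real.exp_nonneg _)
    calc ∑ a ∈ Finset.univ.erase i, P.real (E a) ≤ ∑ a ∈ Finset.univ.erase i, B := by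
          refine Finset.sum_le_sum fun a ha => ?_
          obtain ⟨ha0, ham⟩ := hμ a (Finset.ne_of_mem_erase ha)
          exact hTS.measure_unsettled_ge_le a ha0 ham hmx (by linarith) L T (by positivity)
      _ ≤ ∑ a : Fin K, B :=
          Finset.sum_le_sum_of_subset_of_nonneg (Finset.erase_subset _ _) fun _ _ _ => hB
      _ = K * B := by simp
  · have hpos : 0 < posteriorTail s.1 s.2 y :=
      posteriorTail_pos (Finset.mem_filter.1 hs).2 (hx.trans_le hxy) hy1
    exact hTS.measure_state_ge_le i hi0 hi1 s.1 s.2 T (by positivity)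

/-- The total probability that arm `i` stays long in one of its states: the exponential is at most
a power of its argument, in which the small posterior tails cancel against the small probabilities
of reaching the state. -/
lemma sum_states_le {p y η C z : ℝ} (hy : 0 < y) (hy1 : y < 1) (hη0 : 0 < η) (hη1 : η ≤ 1)
    (hC : 0 < C)
    (h : ∀ n k : ℕ, k ≤ n → binomialProb n k p ≤ C * posteriorTail n k y ^ (1 + η))
    (hz : 0 < z) (n : ℕ) :
    ∑ s ∈ states n, binomialProb s.1 s.2 p * Real.exp (1 - z * posteriorTail s.1 s.2 y) ≤
      ((n : ℝ) + 1) ^ 2 * (2 * Real.exp 1 * C * z ^ (-(1 + η))) := by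
  have hpow : ∀ w : ℝ, 0 < w → w ^ (1 + η) * Real.exp (-w) ≤ 2 := by
    intro w hw
    have h1 : w ^ (1 + η) ≤ 1 + w ^ 2 := by
      rcases le_total w 1 with hw1 | hw1
      · exact (Real.rpow_le_one hw.le hw1 (by linarith)).trans (by nlinarith)
      · calc w ^ (1 + η) ≤ w ^ (2 : ℝ) := Real.rpow_le_rpow_of_exponent_le hw1 (by linarith)
          _ = w ^ 2 := Real.rpow_two w
          _ ≤ _ := by linarith
    have h2 := Real.quadratic_le_exp_of_nonneg hw.le
    rw [Real.exp_neg, ← div_eq_mul_inv, div_le_iff₀ (Real.exp_pos w)]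
    linarith
  have hterm : ∀ s ∈ states n, binomialProb s.1 s.2 p *
      Real.exp (1 - z * posteriorTail s.1 s.2 y) ≤ 2 * Real.exp 1 * C * z ^ (-(1 + η)) := by
    intro s hs
    have hk := (Finset.mem_filter.1 hs).2
    have hpos := posteriorTail_pos hk hy hy1
    set q := posteriorTail s.1 s.2 y
    calc binomialProb s.1 s.2 p * Real.exp (1 - z * q)
        ≤ C * q ^ (1 + η) * Real.exp (1 - z * q) :=
          mul_le_mul_of_nonneg_right (h _ _ hk) (Real.exp_nonneg _)
      _ = Real.exp 1 * C * z ^ (-(1 + η)) * ((z * q) ^ (1 + η) * Real.exp (-(z * q))) := by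
          have : z ^ (-(1 + η)) * z ^ (1 + η) = 1 := by rw [← Real.rpow_add hz]; simp
          rw [Real.mul_rpow hz.le hpos.le, sub_eq_add_neg, Real.exp_add]
          linear_combination -(Real.exp 1 * C * q ^ (1 + η) * Real.exp (-(z * q))) * this
      _ ≤ Real.exp 1 * C * z ^ (-(1 + η)) * 2 := by
          gcongr
          exact hpow _ (by positivity)
      _ = _ := by ring
  refine (Finset.sum_le_sum hterm).trans ?_
  rw [Finset.sum_const, nsmul_eq_mul]
  gcongr
  exact card_states_le n

end FewDraws

lemma succ_le_mul_exp {s : ℝ} (hs : 0 < s) (n : ℕ) :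
    (n : ℝ) + 1 ≤ (1 + 1 / s) * Real.exp (n * s) := by
  have h1 : n * s + 1 ≤ Real.exp (n * s) := Real.add_one_le_exp _
  have h2 : 0 ≤ n * s := by positivity
  calc (n : ℝ) + 1 ≤ (1 + 1 / s) * (n * s + 1) := by
        have : 1 / s * (n * s) = n := by field_simp
        have h3 : 0 < 1 / s := by positivity
        nlinarith
    _ ≤ _ := by gcongr

lemma succ_mul_exp_le {d d' : ℝ} (hd : d' < d) (n : ℕ) :
    ((n : ℝ) + 1) * Real.exp (-(n * d)) ≤ (1 + 1 / (d - d')) * Real.exp (-(n * d')) := by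
  calc _ ≤ (1 + 1 / (d - d')) * Real.exp (n * (d - d')) * Real.exp (-(n * d)) := by
        gcongr
        exact succ_le_mul_exp (sub_pos.2 hd) n
    _ = _ := by rw [mul_assoc, ← Real.exp_add]; ring_nf

lemma summable_exp_neg_nat_mul {d : ℝ} (hd : 0 < d) :
    Summable fun n : ℕ => Real.exp (-(d * n)) := by
  have : ∀ n : ℕ, Real.exp (-(d * n)) = Real.exp (-d) ^ n := fun n => by
    rw [← Real.exp_nat_mul]; ring_nf
  simp_rw [this]
  exact summable_geometric_of_lt_one (Real.exp_nonneg _) (Real.exp_lt_one_iff.2 (by linarith))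

lemma exists_forall_succ_mul_exp_le {d ε : ℝ} (hd : 0 < d) (hε : 0 < ε) :
    ∃ L : ℕ, ∀ n : ℕ, L ≤ n → ((n : ℝ) + 1) * Real.exp (-(n * d)) ≤ ε := by
  have h1 := ((summable_exp_neg_nat_mul (half_pos hd)).tendsto_atTop_zero).const_mul
    (1 + 1 / (d - d / 2))
  rw [mul_zero] at h1
  obtain ⟨L, hL⟩ := eventually_atTop.1 (h1.eventually_lt_const hε)
  refine ⟨L, fun n hn => (succ_mul_exp_le (half_lt_self hd) n).trans ?_⟩
  rw [mul_comm (n : ℝ)]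
  exact (hL n hn).le

/-- The polynomial rate: with `n` a sufficiently small power of `T`, the bound of `sum_states_le`
is a power of `T` with exponent less than `-1`. -/
lemma rpow_rate_le {η C c : ℝ} (hη0 : 0 < η) (hη1 : η ≤ 1) (hC : 0 < C) (hc : 0 < c) {T : ℕ}
    (hT : 0 < T) :
    ((⌊(T : ℝ) ^ (η / 12)⌋₊ : ℝ) + 1) ^ 2 * (2 * Real.exp 1 * C *
      (c * (T / (4 * ((⌊(T : ℝ) ^ (η / 12)⌋₊ : ℝ) + 1) ^ 2))) ^ (-(1 + η))) ≤
    8 * Real.exp 1 * C * (c / 16) ^ (-(1 + η)) * (T : ℝ) ^ (-(1 + η / 2)) := by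
  have hT1 : (1 : ℝ) ≤ T := by exact_mod_cast hT
  have hT0 : (0 : ℝ) < T := by linarith
  set b := η / 12 with hb
  set N : ℝ := (⌊(T : ℝ) ^ b⌋₊ : ℝ) + 1
  have hTb : 1 ≤ (T : ℝ) ^ b := Real.one_le_rpow hT1 (by positivity)
  have hN : N ≤ 2 * (T : ℝ) ^ b := by
    have := Nat.floor_le (show 0 ≤ (T : ℝ) ^ b by positivity)
    simp only [N]; linarith
  have hN0 : 0 < N := by positivity
  have hN2 : N ^ 2 ≤ 4 * (T : ℝ) ^ (2 * b) := by
    calc N ^ 2 ≤ (2 * (T : ℝ) ^ b) ^ 2 := by gcongr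
      _ = 4 * (T : ℝ) ^ (2 * b) := by
          rw [mul_pow, ← Real.rpow_natCast ((T : ℝ) ^ b), ← Real.rpow_mul hT0.le]
          push_cast; ring_nf
  have hz : c / 16 * (T : ℝ) ^ (1 - 2 * b) ≤ c * (T / (4 * N ^ 2)) := by
    rw [Real.rpow_sub hT0, Real.rpow_one]
    calc c / 16 * (T / (T : ℝ) ^ (2 * b)) = c * (T / (4 * (4 * (T : ℝ) ^ (2 * b)))) := by
          field_simp; norm_num
      _ ≤ _ := by gcongr
  have hzpow : (c * (T / (4 * N ^ 2))) ^ (-(1 + η)) ≤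
      (c / 16) ^ (-(1 + η)) * (T : ℝ) ^ ((1 - 2 * b) * -(1 + η)) := by
    rw [Real.rpow_mul hT0.le, ← Real.mul_rpow (by positivity) (by positivity)]
    exact Real.rpow_le_rpow_of_nonpos (by positivity) hz (by linarith)
  calc _ ≤ 4 * (T : ℝ) ^ (2 * b) * (2 * Real.exp 1 * C *
        ((c / 16) ^ (-(1 + η)) * (T : ℝ) ^ ((1 - 2 * b) * -(1 + η)))) := by gcongr
    _ = 8 * Real.exp 1 * C * (c / 16) ^ (-(1 + η)) *
        (T : ℝ) ^ (2 * b + (1 - 2 * b) * -(1 + η)) := by rw [Real.rpow_add hT0]; ring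
    _ ≤ _ := by
        gcongr
        rw [hb]; nlinarith

/-- The optimal arm is drawn at most `T ^ b` times with summable probability. The exponent depends
only on the two largest means, and the bound also on the number of arms. -/
theorem exists_summable_fewDraws {m p : ℝ} (hm : 0 ≤ m) (hmp : m < p) (hp : p < 1) :
    ∃ b : ℝ, 0 < b ∧ b < 1 ∧ ∀ K : ℕ, ∃ g : ℕ → ℝ, Summable g ∧ (∀ T, 0 ≤ g T) ∧
      ∀ (μ : Fin K → ℝ) (i : Fin K), μ i = p → (∀ a, a ≠ i → 0 ≤ μ a ∧ μ a ≤ m) →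
      ∀ (Ω : Type*) [MeasurableSpace Ω] (P : Measure Ω) [IsProbabilityMeasure P]
        (θ : ℕ → Ω → Fin K → ℝ) (A : ℕ → Ω → Fin K) (R : ℕ → Ω → Bool),
        IsThompsonSampling P μ θ A R → ∀ T : ℕ, 0 < T →
          P.real {ω | (draws A R i T ω : ℝ) ≤ (T : ℝ) ^ b} ≤ g T := by
  obtain ⟨x, hmx, hxp⟩ := exists_between hmp
  obtain ⟨y, hxy, hyp⟩ := exists_between hxp
  have hx : 0 < x := hm.trans_lt hmx
  have hy : 0 < y := hx.trans hxy
  have hy1 : y < 1 := hyp.trans hp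
  obtain ⟨η, C, hη0, hη1, hC, hrare⟩ := exists_binomialProb_le_posteriorTail_rpow hy hyp hp
  refine ⟨η / 12, by positivity, by linarith, fun K => ?_⟩
  rcases Nat.eq_zero_or_pos K with rfl | hK
  · exact ⟨0, summable_zero, fun _ => le_rfl, fun μ i => i.elim0⟩
  have hKr : (0 : ℝ) < K := by exact_mod_cast hK
  obtain ⟨L₀, hL₀⟩ := exists_forall_succ_mul_exp_le
    (bernKL_pos hx.le (hxy.trans hy1) hy hy1 hxy.ne) (show 0 < 1 / (4 * (K : ℝ)) by positivity)
  set c := 1 - Real.exp (-1)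
  have hc : 0 < c := sub_pos.2 (Real.exp_lt_one_iff.2 (by norm_num))
  set δ := c / (8 * K) with hδ
  have hδ0 : 0 < δ := by positivity
  set r := (x - m) ^ 2 / 4
  have hr : 0 < r := by
    have : 0 < x - m := by linarith
    positivity
  have hρ : 0 < 1 - Real.exp (-r) := sub_pos.2 (Real.exp_lt_one_iff.2 (by linarith))
  set T₀ := ⌈(L₀ + 1) / δ⌉₊
  set B : ℕ → ℝ := fun T => K * (Real.exp r * Real.exp (-(r * δ * T)) / (1 - Real.exp (-r)) +
    Real.exp (-(δ * T))) +
    8 * Real.exp 1 * C * (c / 16) ^ (-(1 + η)) * (T : ℝ) ^ (-(1 + η / 2)) with hB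
  have hB0 : ∀ T, 0 ≤ B T := fun T => by simp only [hB]; positivity
  have hBs : Summable B := by
    refine Summable.add (Summable.mul_left _ (Summable.add ?_ (summable_exp_neg_nat_mul hδ0)))
      (Summable.mul_left _ (Real.summable_nat_rpow.2 (by linarith)))
    exact ((summable_exp_neg_nat_mul (by positivity)).mul_left _).div_const _
  -- for small `T` the number of draws that settles an arm is not yet large enough
  refine ⟨fun T => B T + if T < T₀ then 1 else 0, ?_, fun T => ?_, ?_⟩
  · refine hBs.add (summable_of_ne_finset_zero (s := Finset.range T₀) fun T hT => ?_)
    rw [if_neg (by simpa using hT)]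
  · have := hB0 T
    dsimp only
    split_ifs <;> linarith
  intro μ i hi hμ Ω _ P _ θ A R hTS T hT
  rcases lt_or_ge T T₀ with hTT | hTT
  · simp only [if_pos hTT]
    exact measureReal_le_one.trans (by linarith [hB0 T])
  simp only [if_neg (not_lt.2 hTT), add_zero]
  have hTr : (0 : ℝ) < T := by exact_mod_cast hT
  set L := ⌊δ * T⌋₊
  have hLle : (L : ℝ) ≤ δ * T := Nat.floor_le (by positivity)
  have hLge : δ * T - 1 ≤ L := (Nat.sub_one_lt_floor _).le
  have hLL : L₀ ≤ L := by
    have h1 : ((L₀ : ℝ) + 1) / δ ≤ T := Nat.ceil_le.1 hTT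
    rw [div_le_iff₀ hδ0] at h1
    exact Nat.le_floor (by linarith)
  have hset : {ω | (draws A R i T ω : ℝ) ≤ (T : ℝ) ^ (η / 12)} =
      {ω | draws A R i T ω ≤ ⌊(T : ℝ) ^ (η / 12)⌋₊} := by
    ext ω
    exact (Nat.le_floor_iff (a := (T : ℝ) ^ (η / 12)) (by positivity)).symm
  rw [hset]
  refine (hTS.measure_draws_le_le i (by linarith) (by linarith) hμ hmx hx hxy.le hy1 _ hT
    fun n hn => hL₀ n (hLL.trans hn)).trans (add_le_add ?_ ?_)
  · refine mul_le_mul_of_nonneg_left (add_le_add (div_le_div_of_nonneg_right ?_ hρ.le) ?_) hKr.le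
    · rw [← Real.exp_nat_mul, ← Real.exp_add, Real.exp_le_exp]
      change (L : ℝ) * -r ≤ r + -(r * δ * T)
      nlinarith
    · rw [Real.exp_le_exp]
      have : c * (T / (4 * K)) = 2 * (δ * T) := by rw [hδ]; field_simp; norm_num
      linarith
  · refine le_trans (le_of_eq ?_) ((sum_states_le hy hy1 hη0 hη1 hC (p := p) hrare
      (z := c * (T / (4 * ((⌊(T : ℝ) ^ (η / 12)⌋₊ : ℝ) + 1) ^ 2))) (by positivity) _).trans
      (rpow_rate_le hη0 hη1 hC hc hT))
    refine Finset.sum_congr rfl fun s _ => ?_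
    rw [hi]
    congr 2
    change 1 - c * _ = _
    ring

/-! ### Draws of a suboptimal arm -/

lemma summable_exp_neg_mul_rpow {s β : ℝ} (hs : 0 < s) (hβ : 0 < β) :
    Summable fun t : ℕ => Real.exp (-s * (t : ℝ) ^ β) := by
  have h1 := (isLittleO_exp_neg_mul_rpow_atTop hs (-(2 / β))).comp_tendsto
    ((tendsto_rpow_atTop hβ).comp tendsto_natCast_atTop_atTop)
  refine summable_of_isBigO_nat (Real.summable_nat_rpow.2 (show (-2 : ℝ) < -1 by norm_num))
    (h1.isBigO.trans (Asymptotics.isBigO_of_le _ fun t => ?_))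
  simp only [Function.comp_apply]
  rw [← Real.rpow_mul (Nat.cast_nonneg t), mul_neg, mul_div_cancel₀ _ hβ.ne']

/-- The samples of an arm with mean above `y` are at most `y` with summable probability, apart from
the rounds in which the arm has been drawn at most `t ^ β` times. -/
lemma exists_summable_sample_le {p y β : ℝ} (hy : 0 < y) (hyp : y < p) (hp : p < 1)
    (hβ : 0 < β) :
    ∃ g : ℕ → ℝ, Summable g ∧ (∀ t, 0 ≤ g t) ∧ ∀ (K : ℕ) (μ : Fin K → ℝ) (i : Fin K), μ i = p →
      ∀ (Ω : Type*) [MeasurableSpace Ω] (P : Measure Ω) [IsProbabilityMeasure P]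
        (θ : ℕ → Ω → Fin K → ℝ) (A : ℕ → Ω → Fin K) (R : ℕ → Ω → Bool),
        IsThompsonSampling P μ θ A R → ∀ t : ℕ,
          P.real {ω | θ t ω i ≤ y} ≤
            P.real {ω | (draws A R i t ω : ℝ) ≤ (t : ℝ) ^ β} + g t := by
  obtain ⟨x, hyx, hxp⟩ := exists_between hyp
  have hx : 0 < x := hy.trans hyx
  have hd := bernKL_pos hx.le (hxp.trans hp) hy (hyp.trans hp) hyx.ne'
  set d := bernKL x y
  set r := (p - x) ^ 2 / 4
  have hr : 0 < r := by
    have : 0 < p - x := by linarith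
    positivity
  have hρ1 : Real.exp (-r) < 1 := Real.exp_lt_one_iff.2 (by linarith)
  have hρ : 0 < 1 - Real.exp (-r) := sub_pos.2 hρ1
  have hd2 : 0 < d - d / 2 := by linarith
  refine ⟨fun t => Real.exp (-r * (t : ℝ) ^ β) / (1 - Real.exp (-r)) +
    (1 + 1 / (d - d / 2)) * Real.exp (-(d / 2) * (t : ℝ) ^ β), ?_, fun t => by positivity, ?_⟩
  · exact ((summable_exp_neg_mul_rpow hr hβ).div_const _).add
      ((summable_exp_neg_mul_rpow (half_pos hd) hβ).mul_left _)
  intro K μ i hi Ω _ P _ θ A R hTS t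
  set L := ⌊(t : ℝ) ^ β⌋₊ + 1
  have hL : (t : ℝ) ^ β < L := by
    have := Nat.lt_floor_add_one ((t : ℝ) ^ β)
    simpa [L] using this
  have hdev := hTS.measure_exists_deviation_le i (by linarith) (by linarith)
    (fun n k => (k : ℝ) < x * n) (Real.exp_nonneg (-r)) hρ1
    (fun n => by
      rw [hi]
      exact sum_binomialProb_lt_le n hx.le hxp hp.le) L
  have hsample := hTS.measure_sample_le t i
    (fun h => L ≤ numDraws i h ∧ x * (numDraws i h : ℝ) ≤ numSuccesses i h) measurableSet_Iic
    (B := Set.Iic y) (c := (1 + 1 / (d - d / 2)) * Real.exp (-(d / 2) * (t : ℝ) ^ β))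
    (by positivity) (fun h hh => by
      refine (posterior_Iic_le_exp (numSuccesses_le_numDraws i h) hyx.le (hxp.trans hp) hh.2).trans
        ((succ_mul_exp_le (half_lt_self hd) _).trans ?_)
      have hn : (t : ℝ) ^ β ≤ numDraws i h := hL.le.trans (by exact_mod_cast hh.1)
      gcongr
      nlinarith)
  have hsub : {ω | θ t ω i ≤ y} ⊆ {ω | (draws A R i t ω : ℝ) ≤ (t : ℝ) ^ β} ∪
      ({ω | ∃ t, L ≤ draws A R i t ω ∧ (successes A R i t ω : ℝ) < x * (draws A R i t ω : ℝ)} ∪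
      {ω | (L ≤ draws A R i t ω ∧ x * (draws A R i t ω : ℝ) ≤ successes A R i t ω) ∧
        θ t ω i ∈ Set.Iic y}) := by
    intro ω hω
    by_cases h1 : (draws A R i t ω : ℝ) ≤ (t : ℝ) ^ β
    · exact Or.inl h1
    · have h2 : L ≤ draws A R i t ω :=
        Nat.succ_le_of_lt ((Nat.floor_lt (by positivity)).2 (not_le.1 h1))
      rcases lt_or_ge (successes A R i t ω : ℝ) (x * (draws A R i t ω : ℝ)) with h3 | h3
      · exact Or.inr (Or.inl ⟨t, h2, h3⟩)
      · exact Or.inr (Or.inr ⟨⟨h2, h3⟩, hω⟩)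
  refine (measureReal_mono hsub).trans ((measureReal_union_le _ _).trans
    (add_le_add le_rfl ((measureReal_union_le _ _).trans (add_le_add (hdev.trans ?_) hsample))))
  refine div_le_div_of_nonneg_right ?_ hρ.le
  rw [← Real.exp_nat_mul, Real.exp_le_exp]
  nlinarith

section

variable {K : ℕ} {Ω : Type*} [MeasurableSpace Ω] {P : Measure Ω}
  {μ : Fin K → ℝ} {θ : ℕ → Ω → Fin K → ℝ} {A : ℕ → Ω → Fin K} {R : ℕ → Ω → Bool}

lemma IsThompsonSampling.measurableSet_history_draw (hTS : IsThompsonSampling P μ θ A R)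
    (a : Fin K) (t : ℕ) (Q : History K t → Prop) :
    MeasurableSet {ω | Q (history A R t ω) ∧ A t ω = a} :=
  (measurableSet_history hTS.measurable_arm hTS.measurable_reward t Q).inter
    (hTS.measurable_arm t (measurableSet_singleton a))

variable [IsProbabilityMeasure P]

lemma IsThompsonSampling.sum_measure_draws_lt_le (hTS : IsThompsonSampling P μ θ A R)
    (a : Fin K) (L T : ℕ) :
    ∑ t ∈ Finset.range T, P.real {ω | draws A R a t ω < L ∧ A t ω = a} ≤ L := by
  classical
  have hm := fun t => hTS.measurableSet_history_draw a t fun h => numDraws a h < L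
  have e : ∀ t, P.real {ω | draws A R a t ω < L ∧ A t ω = a} =
      ∫ ω, {ω | draws A R a t ω < L ∧ A t ω = a}.indicator 1 ω ∂P :=
    fun t => (integral_indicator_one (hm t)).symm
  have hint : ∀ t ∈ Finset.range T, Integrable
      (fun ω => {ω | draws A R a t ω < L ∧ A t ω = a}.indicator (1 : Ω → ℝ) ω) P :=
    fun t _ => (integrable_const (1 : ℝ)).indicator (hm t)
  simp_rw [e]
  rw [← integral_finsetSum _ hint]
  calc _ ≤ ∫ _, (L : ℝ) ∂P := by
        refine integral_mono (integrable_finsetSum _ hint) (integrable_const _) fun ω => ?_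
        refine le_trans (le_of_eq ?_) (sum_draws_lt_le (A := A) (R := R) a L T ω)
        simp [Set.indicator, and_comm]
    _ = L := by simp

lemma IsThompsonSampling.integral_draws (hTS : IsThompsonSampling P μ θ A R) (a : Fin K)
    (T : ℕ) :
    ∫ ω, (draws A R a T ω : ℝ) ∂P = ∑ t ∈ Finset.range T, P.real {ω | A t ω = a} := by
  have hm : ∀ t, MeasurableSet {ω | A t ω = a} :=
    fun t => hTS.measurable_arm t (measurableSet_singleton a)
  have hint : ∀ t ∈ Finset.range T, Integrable
      (fun ω => {ω | A t ω = a}.indicator (1 : Ω → ℝ) ω) P :=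
    fun t _ => (integrable_const (1 : ℝ)).indicator (hm t)
  have e : ∀ ω, (draws A R a T ω : ℝ) =
      ∑ t ∈ Finset.range T, {ω | A t ω = a}.indicator (1 : Ω → ℝ) ω := by
    intro ω
    rw [draws_eq_sum]
    simp [Set.indicator]
  simp_rw [e]
  rw [integral_finsetSum _ hint]
  exact Finset.sum_congr rfl fun t _ => integral_indicator_one (hm t)

lemma IsThompsonSampling.sum_measure_deviation_le (hTS : IsThompsonSampling P μ θ A R)
    (a : Fin K) {x : ℝ} (h0 : 0 ≤ μ a) (hx : μ a < x) (hx1 : x ≤ 1) (T : ℕ) :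
    ∑ t ∈ Finset.range T,
      P.real {ω | x * (draws A R a t ω : ℝ) < successes A R a t ω ∧ A t ω = a} ≤
      1 / (1 - Real.exp (-((x - μ a) ^ 2 / 4))) := by
  set ρ := Real.exp (-((x - μ a) ^ 2 / 4))
  have hρ0 : 0 ≤ ρ := Real.exp_nonneg _
  have hρ1 : ρ < 1 := by
    refine Real.exp_lt_one_iff.2 ?_
    have : 0 < x - μ a := by linarith
    have : 0 < (x - μ a) ^ 2 / 4 := by positivity
    linarith
  have hsum := hasSum_geometric_of_lt_one hρ0 hρ1
  have key : ∑' t, P {ω | x * (draws A R a t ω : ℝ) < successes A R a t ω ∧ A t ω = a} ≤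
      ENNReal.ofReal (1 / (1 - ρ)) := by
    calc _ ≤ ∑' t, ∑' n : ℕ, P {ω | (draws A R a t ω = n ∧
            x * (n : ℝ) < (successes A R a t ω : ℝ)) ∧ A t ω = a} := by
          refine ENNReal.tsum_le_tsum fun t => le_trans (measure_mono ?_) (measure_iUnion_le _)
          exact fun ω hω => Set.mem_iUnion.2 ⟨draws A R a t ω, ⟨rfl, hω.1⟩, hω.2⟩
      _ = ∑' n : ℕ, ∑' t, P {ω | (draws A R a t ω = n ∧
            x * (n : ℝ) < (successes A R a t ω : ℝ)) ∧ A t ω = a} := ENNReal.tsum_comm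
      _ ≤ ∑' n : ℕ, ENNReal.ofReal (ρ ^ n) := by
          refine ENNReal.tsum_le_tsum fun n => ?_
          refine (hTS.tsum_measure_draw_le a n fun k => x * (n : ℝ) < (k : ℝ)).trans
            ((hTS.measure_exists_draws_eq_le a h0 (by linarith) n
              fun k => x * (n : ℝ) < (k : ℝ)).trans (ENNReal.ofReal_le_ofReal ?_))
          exact sum_binomialProb_gt_le n h0 le_rfl hx hx1
      _ = _ := by
          rw [one_div, ← hsum.tsum_eq, ENNReal.ofReal_tsum_of_nonneg (fun n => by positivity)
            hsum.summable]
  have hpos : 0 ≤ 1 / (1 - ρ) := div_nonneg zero_le_one (by linarith)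
  have h1 := (ENNReal.sum_le_tsum (Finset.range T)).trans key
  have h2 := ENNReal.toReal_le_of_le_ofReal hpos h1
  rwa [ENNReal.toReal_sum fun _ _ => measure_ne_top _ _] at h2

/-- The expected number of draws of an arm with mean below `x` that are due to a sample exceeding
`y` is at most `ln T / d'` up to a constant, for every `d' < K(x, y)`: after `ln T / d'` draws the
arm is settled, and the probability of such a sample is of order `1 / T`. -/
lemma IsThompsonSampling.sum_measure_sample_gt_le (hTS : IsThompsonSampling P μ θ A R)
    (a : Fin K) {x y d' : ℝ} (h0 : 0 ≤ μ a) (hx : μ a < x) (hxy : x < y) (hy1 : y < 1)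
    (hd0 : 0 < d') (hd' : d' < bernKL x y) {T : ℕ} (hT : 0 < T) :
    ∑ t ∈ Finset.range T, P.real {ω | A t ω = a ∧ y < θ t ω a} ≤
      Real.log T / d' + 1 + (1 + 1 / (bernKL x y - d')) +
        1 / (1 - Real.exp (-((x - μ a) ^ 2 / 4))) := by
  have hx0 : 0 < x := h0.trans_lt hx
  have hTr : (0 : ℝ) < T := by exact_mod_cast hT
  have hT1 : (1 : ℝ) ≤ T := by exact_mod_cast hT
  have hlog : 0 ≤ Real.log T / d' := div_nonneg (Real.log_nonneg hT1) hd0.le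
  have hdd : 0 < bernKL x y - d' := by linarith
  set L := ⌈Real.log T / d'⌉₊
  set C := 1 + 1 / (bernKL x y - d')
  have hC : 0 ≤ C := by positivity
  have hL1 : (L : ℝ) ≤ Real.log T / d' + 1 := (Nat.ceil_lt_add_one hlog).le
  have hL2 : Real.log T ≤ L * d' := (div_le_iff₀ hd0).1 (Nat.le_ceil _)
  have hsample : ∀ t, P.real {ω | (L ≤ draws A R a t ω ∧
      (successes A R a t ω : ℝ) ≤ x * (draws A R a t ω : ℝ)) ∧ θ t ω a ∈ Set.Ioi y} ≤ C / T := by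
    intro t
    refine hTS.measure_sample_le t a (fun h => L ≤ numDraws a h ∧
      (numSuccesses a h : ℝ) ≤ x * (numDraws a h : ℝ)) measurableSet_Ioi (by positivity)
      fun h hh => ?_
    refine (posteriorTail_le_exp (numSuccesses_le_numDraws a h) hx0 hxy.le hh.2).trans
      ((succ_mul_exp_le hd' _).trans ?_)
    rw [div_eq_mul_inv]
    refine mul_le_mul_of_nonneg_left ?_ hC
    rw [← Real.exp_log hTr, ← Real.exp_neg, Real.exp_le_exp, neg_le_neg_iff]
    refine hL2.trans ?_
    have : (L : ℝ) ≤ numDraws a h := by exact_mod_cast hh.1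
    gcongr
  have hround : ∀ t, P.real {ω | A t ω = a ∧ y < θ t ω a} ≤
      P.real {ω | draws A R a t ω < L ∧ A t ω = a} + (C / T +
      P.real {ω | x * (draws A R a t ω : ℝ) < successes A R a t ω ∧ A t ω = a}) := by
    intro t
    refine le_trans (measureReal_mono ?_) ((measureReal_union_le _ _).trans (add_le_add le_rfl
      ((measureReal_union_le _ _).trans (add_le_add (hsample t) le_rfl))))
    rintro ω ⟨h1, h2⟩
    rcases lt_or_ge (draws A R a t ω) L with h3 | h3
    · exact Or.inl ⟨h3, h1⟩
    · rcases lt_or_ge (x * (draws A R a t ω : ℝ)) (successes A R a t ω) with h4 | h4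
      · exact Or.inr (Or.inr ⟨h4, h1⟩)
      · exact Or.inr (Or.inl ⟨⟨h3, h4⟩, h2⟩)
  refine (Finset.sum_le_sum fun t _ => hround t).trans ?_
  rw [Finset.sum_add_distrib, Finset.sum_add_distrib, Finset.sum_const, Finset.card_range,
    nsmul_eq_mul, mul_div_cancel₀ _ hTr.ne']
  have h1 := hTS.sum_measure_draws_lt_le a L T
  have h2 := hTS.sum_measure_deviation_le a h0 hx (by linarith) T
  linarith

lemma IsThompsonSampling.measure_arm_le (hTS : IsThompsonSampling P μ θ A R) (i a : Fin K)
    (t : ℕ) (y : ℝ) :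
    P.real {ω | A t ω = a} ≤
      P.real {ω | θ t ω i ≤ y} + P.real {ω | A t ω = a ∧ y < θ t ω a} := by
  refine le_trans (ENNReal.toReal_mono (measure_ne_top _ _) (measure_mono_ae ?_))
    (measureReal_union_le {ω | θ t ω i ≤ y} {ω | A t ω = a ∧ y < θ t ω a})
  filter_upwards [hTS.arm_argmax t] with ω hω h1
  rcases lt_or_ge y (θ t ω a) with h2 | h2
  · exact Or.inr ⟨h1, h2⟩
  · have h1 : A t ω = a := h1
    refine Or.inl ((hω i).trans ?_)
    rw [h1]
    exact h2

lemma one_le_fewDrawsSum (A : ℕ → Ω → Fin K) (R : ℕ → Ω → Bool) (i : Fin K) (β : ℝ) :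
    1 ≤ fewDrawsSum P A R i β := by
  refine le_trans (le_of_eq ?_) (ENNReal.le_tsum 0)
  have : {ω | (draws A R i (0 + 1) ω : ℝ) ≤ ((0 + 1 : ℕ) : ℝ) ^ β} = Set.univ := by
    refine Set.eq_univ_of_forall fun ω => ?_
    have : draws A R i (0 + 1) ω ≤ 1 := by
      rw [draws_succ, draws_zero]
      split_ifs <;> simp
    simpa using this
  rw [this, measure_univ]

end

/-- Moving the arguments of the divergence slightly towards each other costs little. -/
lemma exists_bernKL_gt {q p ε : ℝ} (hq : 0 ≤ q) (hqp : q < p) (hp : p < 1) (hε : 0 < ε) :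
    ∃ x y : ℝ, q < x ∧ x < y ∧ y < p ∧ bernKL q p / (1 + ε) < bernKL x y := by
  have hp0 : 0 < p := hq.trans_lt hqp
  have hd := bernKL_pos hq (hqp.trans hp) hp0 hp hqp.ne
  set G : ℝ → ℝ := fun s => (q + s) * Real.log (q + s) - (q + s) * Real.log (p - s) +
    ((1 - (q + s)) * Real.log (1 - (q + s)) - (1 - (q + s)) * Real.log (1 - (p - s))) with hG
  have hGeq : ∀ s, 0 ≤ s → s < (p - q) / 2 → G s = bernKL (q + s) (p - s) := by
    intro s hs hs2
    have h1 : (q + s) * Real.log ((q + s) / (p - s)) =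
        (q + s) * Real.log (q + s) - (q + s) * Real.log (p - s) := by
      rcases (show 0 ≤ q + s by linarith).eq_or_lt with h | h
      · rw [← h]; simp
      · rw [Real.log_div h.ne' (by linarith)]; ring
    have h2 : (1 - (q + s)) * Real.log ((1 - (q + s)) / (1 - (p - s))) =
        (1 - (q + s)) * Real.log (1 - (q + s)) - (1 - (q + s)) * Real.log (1 - (p - s)) := by
      rw [Real.log_div (by linarith) (by linarith)]; ring
    rw [bernKL, h1, h2]
  have hcont : ContinuousAt G 0 := by
    have c1 : ContinuousAt (fun s : ℝ => (q + s) * Real.log (q + s)) 0 :=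
      (Real.continuous_mul_log.comp (by fun_prop : Continuous fun s : ℝ => q + s)).continuousAt
    have c2 : ContinuousAt (fun s : ℝ => Real.log (p - s)) 0 :=
      ContinuousAt.log (by fun_prop) (by simpa using hp0.ne')
    have c3 : ContinuousAt (fun s : ℝ => Real.log (1 - (q + s))) 0 :=
      ContinuousAt.log (by fun_prop) (by rw [add_zero]; linarith)
    have c4 : ContinuousAt (fun s : ℝ => Real.log (1 - (p - s))) 0 :=
      ContinuousAt.log (by fun_prop) (by rw [sub_zero]; linarith)
    simp only [hG]
    fun_prop
  have hlt : bernKL q p / (1 + ε) < G 0 := by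
    rw [hGeq 0 le_rfl (by linarith), add_zero, sub_zero]
    exact div_lt_self hd (by linarith)
  have h1 : ∀ᶠ s in nhdsWithin (0 : ℝ) (Set.Ioi 0), bernKL q p / (1 + ε) < G s :=
    (continuousAt_const.eventually_lt hcont hlt).filter_mono nhdsWithin_le_nhds
  have h2 : ∀ᶠ s in nhdsWithin (0 : ℝ) (Set.Ioi 0), s ∈ Set.Ioo 0 ((p - q) / 2) :=
    Ioo_mem_nhdsGT (by linarith)
  obtain ⟨s, hs, hs0, hs1⟩ := (h1.and h2).exists
  rw [hGeq s hs0.le hs1] at hs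
  exact ⟨q + s, p - s, by linarith, by linarith, by linarith, hs⟩

/-- The finite-time bound on the draws of a suboptimal arm with mean `q`, when the optimal arm has
mean `p`. -/
theorem exists_integral_draws_le {q p ε : ℝ} (hq : 0 ≤ q) (hqp : q < p) (hp : p < 1)
    (hε : 0 < ε) :
    ∃ (D : ℝ) (N : ℝ → ℝ), 0 ≤ D ∧ (∀ β, 0 < β → 0 ≤ N β) ∧
      ∀ (K : ℕ) (μ : Fin K → ℝ) (i a : Fin K), μ i = p → μ a = q →
      ∀ (Ω : Type*) [MeasurableSpace Ω] (P : Measure Ω) [IsProbabilityMeasure P]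
        (θ : ℕ → Ω → Fin K → ℝ) (A : ℕ → Ω → Fin K) (R : ℕ → Ω → Bool),
        IsThompsonSampling P μ θ A R → ∀ β c : ℝ, 0 < β →
          fewDrawsSum P A R i β ≤ ENNReal.ofReal c → ∀ T : ℕ, 0 < T →
            ∫ ω, (draws A R a T ω : ℝ) ∂P ≤
              (1 + ε) * (Real.log T / bernKL q p) + D + N β + 1 + c := by
  obtain ⟨x, y, hqx, hxy, hyp, hd⟩ := exists_bernKL_gt hq hqp hp hε
  have hx : 0 < x := hq.trans_lt hqx
  have hy : 0 < y := hx.trans hxy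
  have hd0 : 0 < bernKL q p / (1 + ε) :=
    div_pos (bernKL_pos hq (hqp.trans hp) (hy.trans hyp) hp hqp.ne) (by linarith)
  have hN : ∀ β : ℝ, ∃ g : ℕ → ℝ, 0 < β → _ := fun β => by
    by_cases hβ : 0 < β
    · obtain ⟨g, hg⟩ := exists_summable_sample_le hy hyp hp hβ
      exact ⟨g, fun _ => hg⟩
    · exact ⟨0, fun h => absurd h hβ⟩
  choose g hg using hN
  have hρ : 0 < 1 - Real.exp (-((x - q) ^ 2 / 4)) := by
    have : 0 < x - q := by linarith
    have : 0 < (x - q) ^ 2 / 4 := by positivity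
    exact sub_pos.2 (Real.exp_lt_one_iff.2 (by linarith))
  have hdd : 0 < bernKL x y - bernKL q p / (1 + ε) := by linarith
  refine ⟨1 + (1 + 1 / (bernKL x y - bernKL q p / (1 + ε))) +
    1 / (1 - Real.exp (-((x - q) ^ 2 / 4))), fun β => ∑' t, g β t, by positivity,
    fun β hβ => tsum_nonneg (hg β hβ).2.1, ?_⟩
  intro K μ i a hi ha Ω _ P _ θ A R hTS β c hβ hc T hT
  obtain ⟨hgs, hg0, hg⟩ := hg β hβ
  have hc1 : 1 ≤ c := by
    have := (one_le_fewDrawsSum (P := P) A R i β).trans hc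
    rwa [ENNReal.one_le_ofReal] at this
  have h1 := hTS.sum_measure_sample_gt_le a (ha ▸ hq) (ha ▸ hqx) hxy (hyp.trans hp) hd0 hd hT
  have h2 : ∑ t ∈ Finset.range T, P.real {ω | θ t ω i ≤ y} ≤ 1 + (c + ∑' t, g β t) := by
    obtain ⟨S, rfl⟩ := Nat.exists_eq_succ_of_ne_zero hT.ne'
    rw [Nat.succ_eq_add_one, Finset.sum_range_succ', add_comm]
    refine add_le_add measureReal_le_one ?_
    refine (Finset.sum_le_sum fun t _ => hg K μ i hi Ω P θ A R hTS (t + 1)).trans ?_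
    rw [Finset.sum_add_distrib]
    refine add_le_add ?_ ?_
    · simp only [Measure.real]
      rw [← ENNReal.toReal_sum fun _ _ => measure_ne_top _ _]
      refine ENNReal.toReal_le_of_le_ofReal (by linarith) (le_trans ?_ hc)
      exact ENNReal.sum_le_tsum (Finset.range S)
    · have h3 := hgs.sum_le_tsum (Finset.range (S + 1)) fun t _ => hg0 t
      rw [Finset.sum_range_succ'] at h3
      linarith [hg0 0]
  rw [hTS.integral_draws a T]
  refine (Finset.sum_le_sum fun t _ => hTS.measure_arm_le i a t y).trans ?_
  rw [Finset.sum_add_distrib]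
  have e : Real.log T / (bernKL q p / (1 + ε)) = (1 + ε) * (Real.log T / bernKL q p) := by
    rw [div_div_eq_mul_div]; ring
  rw [e, ha] at h1
  linarith

/-! ### The constants -/

universe u

lemma fewDrawsSum_le_tsum {K : ℕ} {Ω : Type*} [MeasurableSpace Ω] {P : Measure Ω}
    [IsProbabilityMeasure P] {A : ℕ → Ω → Fin K} {R : ℕ → Ω → Bool} {i : Fin K} {b : ℝ}
    {g : ℕ → ℝ} (hg : Summable g) (hg0 : ∀ T, 0 ≤ g T)
    (h : ∀ T : ℕ, 0 < T → P.real {ω | (draws A R i T ω : ℝ) ≤ (T : ℝ) ^ b} ≤ g T) :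
    fewDrawsSum P A R i b ≤ ENNReal.ofReal (∑' T, g (T + 1)) := by
  rw [ENNReal.ofReal_tsum_of_nonneg (fun T => hg0 _) ((summable_nat_add_iff 1).2 hg)]
  refine ENNReal.tsum_le_tsum fun T => ?_
  exact (ENNReal.le_ofReal_iff_toReal_le (measure_ne_top _ _) (hg0 _)).2 (h (T + 1) T.succ_pos)

lemma log_add_log_log_nonneg {T : ℕ} (hT : 2 ≤ T) :
    0 ≤ Real.log T + Real.log (Real.log T) := by
  have h2 : (1 : ℝ) / 2 < Real.log 2 := by linarith [Real.log_two_gt_d9]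
  have hT' : Real.log 2 ≤ Real.log T := Real.log_le_log two_pos (by exact_mod_cast hT)
  have h3 : Real.log (1 / 2) ≤ Real.log (Real.log T) :=
    Real.log_le_log (by norm_num) (by linarith)
  rw [one_div, Real.log_inv] at h3
  linarith

lemma log_log_nonneg {T : ℕ} (hT : 3 ≤ T) : 0 ≤ Real.log (Real.log T) := by
  refine Real.log_nonneg ?_
  have hT' : (3 : ℝ) ≤ T := by exact_mod_cast hT
  rw [Real.le_log_iff_exp_le (by linarith)]
  linarith [Real.exp_one_lt_d9]

/-- The constants of the summability statement, as functions of the parameters. -/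
theorem exists_fewDrawsSum_constants : ∃ (b : ℝ → ℝ → ℝ) (C : ℝ → ℝ → ℕ → ℝ), ∀ (p m : ℝ) (K : ℕ),
    0 ≤ m → m < p → p < 1 → 0 < b p m ∧ b p m < 1 ∧
      ∀ (μ : Fin K → ℝ) (i : Fin K), μ i = p → (∀ a, a ≠ i → 0 ≤ μ a ∧ μ a ≤ m) →
      ∀ (Ω : Type u) [MeasurableSpace Ω] (P : Measure Ω) [IsProbabilityMeasure P]
        (θ : ℕ → Ω → Fin K → ℝ) (A : ℕ → Ω → Fin K) (R : ℕ → Ω → Bool),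
        IsThompsonSampling P μ θ A R →
          fewDrawsSum P A R i (b p m) ≤ ENNReal.ofReal (C p m K) := by
  have hfew : ∀ p m : ℝ, ∃ b : ℝ, ∀ K : ℕ, ∃ C : ℝ, 0 ≤ m → m < p → p < 1 → 0 < b ∧ b < 1 ∧
      ∀ (μ : Fin K → ℝ) (i : Fin K), μ i = p → (∀ a, a ≠ i → 0 ≤ μ a ∧ μ a ≤ m) →
      ∀ (Ω : Type u) [MeasurableSpace Ω] (P : Measure Ω) [IsProbabilityMeasure P]
        (θ : ℕ → Ω → Fin K → ℝ) (A : ℕ → Ω → Fin K) (R : ℕ → Ω → Bool),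
        IsThompsonSampling P μ θ A R → fewDrawsSum P A R i b ≤ ENNReal.ofReal C := by
    intro p m
    by_cases h : 0 ≤ m ∧ m < p ∧ p < 1
    · obtain ⟨b, hb0, hb1, hb⟩ := exists_summable_fewDraws h.1 h.2.1 h.2.2
      refine ⟨b, fun K => ?_⟩
      obtain ⟨g, hgs, hg0, hg⟩ := hb K
      refine ⟨∑' T, g (T + 1), fun _ _ _ => ⟨hb0, hb1, ?_⟩⟩
      intro μ i hi hμ Ω _ P _ θ A R hTS
      exact fewDrawsSum_le_tsum hgs hg0 (hg μ i hi hμ Ω P θ A R hTS)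
    · exact ⟨0, fun K => ⟨0, fun h1 h2 h3 => absurd ⟨h1, h2, h3⟩ h⟩⟩
  choose b C hbC using hfew
  exact ⟨b, C, hbC⟩

/-- The constants of the finite-time bound, as functions of the parameters. -/
theorem exists_integral_draws_constants : ∃ (D : ℝ → ℝ → ℝ → ℝ) (N : ℝ → ℝ → ℝ → ℝ → ℝ),
    ∀ ε p q : ℝ, 0 ≤ q → q < p → p < 1 → 0 < ε →
      0 ≤ D ε p q ∧ (∀ β, 0 < β → 0 ≤ N ε p q β) ∧
      ∀ (K : ℕ) (μ : Fin K → ℝ) (i a : Fin K), μ i = p → μ a = q →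
      ∀ (Ω : Type u) [MeasurableSpace Ω] (P : Measure Ω) [IsProbabilityMeasure P]
        (θ : ℕ → Ω → Fin K → ℝ) (A : ℕ → Ω → Fin K) (R : ℕ → Ω → Bool),
        IsThompsonSampling P μ θ A R → ∀ β c : ℝ, 0 < β →
          fewDrawsSum P A R i β ≤ ENNReal.ofReal c → ∀ T : ℕ, 0 < T →
            ∫ ω, (draws A R a T ω : ℝ) ∂P ≤
              (1 + ε) * (Real.log T / bernKL q p) + D ε p q + N ε p q β + 1 + c := by
  have hbound : ∀ ε p q : ℝ, ∃ (D : ℝ) (N : ℝ → ℝ), 0 ≤ q → q < p → p < 1 → 0 < ε →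
      0 ≤ D ∧ (∀ β, 0 < β → 0 ≤ N β) ∧
      ∀ (K : ℕ) (μ : Fin K → ℝ) (i a : Fin K), μ i = p → μ a = q →
      ∀ (Ω : Type u) [MeasurableSpace Ω] (P : Measure Ω) [IsProbabilityMeasure P]
        (θ : ℕ → Ω → Fin K → ℝ) (A : ℕ → Ω → Fin K) (R : ℕ → Ω → Bool),
        IsThompsonSampling P μ θ A R → ∀ β c : ℝ, 0 < β →
          fewDrawsSum P A R i β ≤ ENNReal.ofReal c → ∀ T : ℕ, 0 < T →
            ∫ ω, (draws A R a T ω : ℝ) ∂P ≤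
              (1 + ε) * (Real.log T / bernKL q p) + D + N β + 1 + c := by
    intro ε p q
    by_cases h : 0 ≤ q ∧ q < p ∧ p < 1 ∧ 0 < ε
    · obtain ⟨D, N, hDN⟩ := exists_integral_draws_le h.1 h.2.1 h.2.2.1 h.2.2.2
      exact ⟨D, N, fun _ _ _ _ => hDN⟩
    · exact ⟨0, 0, fun h1 h2 h3 h4 => absurd ⟨h1, h2, h3, h4⟩ h⟩
  choose D N hDN using hbound
  exact ⟨D, N, hDN⟩

end ThompsonBandit

open ThompsonBandit in
theorem theorem2 :
    ∃ (b : ℝ → ℝ → ℝ) (C : ℕ → ℝ → ℝ → ℝ) (D : ℝ → ℝ → ℝ → ℝ)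
      (N : ℝ → ℝ → ℝ → ℝ → ℝ) (N₀ : ℝ → ℝ),
      ∀ (K : ℕ) (μ : Fin K → ℝ) (i₁ i₂ : Fin K),
        (∀ a, μ a ∈ Set.Ico (0 : ℝ) 1) → μ i₂ < μ i₁ → (∀ a, a ≠ i₁ → μ a ≤ μ i₂) →
      ∀ (Ω : Type*) [MeasurableSpace Ω] (P : Measure Ω) [IsProbabilityMeasure P]
        (θ : ℕ → Ω → Fin K → ℝ) (A : ℕ → Ω → Fin K) (R : ℕ → Ω → Bool),
        ThompsonBandit.IsThompsonSampling P μ θ A R →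
        -- the constants `b(μ₁, μ₂)` and `C_b` exist
        (0 < b (μ i₁) (μ i₂) ∧ b (μ i₁) (μ i₂) < 1 ∧
          ThompsonBandit.fewDrawsSum P A R i₁ (b (μ i₁) (μ i₂)) ≤
            ENNReal.ofReal (C K (μ i₁) (μ i₂))) ∧
        -- the finite-time bound, for all constants `β` and `c` that can play their role
        (∀ β c : ℝ, 0 < β → β < 1 →
          ThompsonBandit.fewDrawsSum P A R i₁ β ≤ ENNReal.ofReal c →
          ∀ ε : ℝ, 0 < ε → ∀ a : Fin K, a ≠ i₁ → ∀ T : ℕ, 2 ≤ T →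
            ∫ ω, (ThompsonBandit.draws A R a T ω : ℝ) ∂P ≤
              (1 + ε) * ((Real.log T + Real.log (Real.log T)) /
                  ThompsonBandit.bernKL (μ a) (μ i₁)) +
                D ε (μ i₁) (μ a) + N β ε (μ i₁) (μ a) + N₀ β + 5 + 2 * c) ∧
        -- asymptotically the constant is that of the lower bound of Lai and Robbins
        (∀ a : Fin K, a ≠ i₁ →
          limsup (fun T : ℕ =>
              (((∫ ω, (ThompsonBandit.draws A R a T ω : ℝ) ∂P) / Real.log T : ℝ) : EReal)) atTop ≤
            ((1 / ThompsonBandit.bernKL (μ a) (μ i₁) : ℝ) : EReal)) := by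
  obtain ⟨b, C, hbC⟩ := exists_fewDrawsSum_constants
  obtain ⟨D, N, hDN⟩ := exists_integral_draws_constants
  -- the bound `N` already covers everything that depends on the exponent alone
  refine ⟨b, fun K p m => C p m K, D, fun β ε p q => N ε p q β, fun _ => 0, ?_⟩
  intro K μ i₁ i₂ hμ h12 hbest Ω _ P _ θ A R hTS
  have hp1 := (hμ i₁).2
  obtain ⟨hb0, hb1, hC⟩ := hbC (μ i₁) (μ i₂) K (hμ i₂).1 h12 hp1
  have hsum := hC μ i₁ rfl (fun a ha => ⟨(hμ a).1, hbest a ha⟩) Ω P θ A R hTS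
  refine ⟨⟨hb0, hb1, hsum⟩, ?_, ?_⟩
  · intro β c hβ _ hc ε hε a ha T hT
    have hap : μ a < μ i₁ := (hbest a ha).trans_lt h12
    obtain ⟨hD0, hN0, hE⟩ := hDN ε (μ i₁) (μ a) (hμ a).1 hap hp1 hε
    have hKL := bernKL_pos (hμ a).1 (hμ a).2 ((hμ a).1.trans_lt hap) hp1 hap.ne
    have hc1 : 1 ≤ c := by
      have := (one_le_fewDrawsSum (P := P) A R i₁ β).trans hc
      rwa [ENNReal.one_le_ofReal] at this
    have hNβ := hN0 β hβ
    rcases hT.eq_or_lt with rfl | hT3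
    · -- `ln ln 2 < 0`, but two rounds have at most two draws
      have h1 : ∫ ω, (draws A R a 2 ω : ℝ) ∂P ≤ 2 := by
        rw [hTS.integral_draws a 2, Finset.sum_range_succ, Finset.sum_range_one]
        have h0 : P.real {ω | A 0 ω = a} ≤ 1 := measureReal_le_one
        have h1 : P.real {ω | A 1 ω = a} ≤ 1 := measureReal_le_one
        linarith
      have h2 := mul_nonneg (show 0 ≤ 1 + ε by linarith)
        (div_nonneg (log_add_log_log_nonneg (le_refl 2)) hKL.le)
      linarith
    · have h1 := hE K μ i₁ a rfl rfl Ω P θ A R hTS β c hβ hc T (by omega)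
      have h2 : (1 + ε) * (Real.log T / bernKL (μ a) (μ i₁)) ≤
          (1 + ε) * ((Real.log T + Real.log (Real.log T)) / bernKL (μ a) (μ i₁)) := by
        have := log_log_nonneg hT3
        gcongr
        linarith
      linarith
  · intro a ha
    have hap : μ a < μ i₁ := (hbest a ha).trans_lt h12
    have hKL := bernKL_pos (hμ a).1 (hμ a).2 ((hμ a).1.trans_lt hap) hp1 hap.ne
    set κ := bernKL (μ a) (μ i₁)
    refine EReal.le_of_forall_lt_iff_le.1 fun z hz => ?_
    have hz : 1 / κ < z := EReal.coe_lt_coe_iff.1 hz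
    -- `ε` is such that `(1 + ε) / κ` is half-way between `1 / κ` and `z`
    set ε := (z * κ - 1) / 2 with hε
    have hε0 : 0 < ε := by
      rw [div_lt_iff₀ hKL] at hz
      simp only [hε]; linarith
    obtain ⟨-, -, hE⟩ := hDN ε (μ i₁) (μ a) (hμ a).1 hap hp1 hε0
    set M := D ε (μ i₁) (μ a) + N ε (μ i₁) (μ a) (b (μ i₁) (μ i₂)) + 1 + C (μ i₁) (μ i₂) K
    have hlog : Tendsto (fun T : ℕ => Real.log T) atTop atTop :=
      Real.tendsto_log_atTop.comp tendsto_natCast_atTop_atTop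
    have hlim : Tendsto (fun T : ℕ => (1 + ε) / κ + M / Real.log T) atTop
        (nhds ((1 + ε) / κ + 0)) := tendsto_const_nhds.add (hlog.const_div_atTop M)
    have hlt : (1 + ε) / κ + 0 < z := by
      rw [add_zero, div_lt_iff₀ hKL]
      linarith
    refine limsup_le_of_le (by isBoundedDefault) ?_
    filter_upwards [hlim.eventually_lt_const hlt, eventually_ge_atTop 2] with T hT hT2
    have hlogT : 0 < Real.log T := Real.log_pos (by exact_mod_cast hT2)
    have h1 := hE K μ i₁ a rfl rfl Ω P θ A R hTS _ _ hb0 hsum T (by omega)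
    refine EReal.coe_le_coe_iff.2 (le_trans ?_ hT.le)
    rw [div_le_iff₀ hlogT, add_mul, div_mul_cancel₀ _ hlogT.ne']
    have h2 : (1 + ε) / κ * Real.log T = (1 + ε) * (Real.log T / κ) := by ring
    linarith
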